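/- **Setting.** Let $P=\{p\in\mathbb R^n : A_Pp+b_P\ge 0\}$ be a simple $n$-dimensional convex polytope, the bounded intersection of $m$ irredundant halfspaces, where the rows of the $m\times n$ matrix $A_P$ are the inward pointing unit normals to the facets $F_1,\dots,F_m$; orient $P$ by the standard orientation of $\mathbb R^n$. Let $(P,\varLambda)$ be a combinatorial quasitoric pair: $F_1\cap\dots\cap F_n$ is a vertex, and $\varLambda=(\lambda_1\ \dots\ \lambda_m)$ is an integral $n\times m$ matrix such that $(\lambda_1\ \dots\ \lambda_n)=I_n$ and $\det(\lambda_{j_1}\ \dots\ \lambda_{j_n})=\pm1$ whenever $F_{j_1}\cap\dots\cap F_{j_n}$ is a vertex of $P$. Let $\mathcal Z_P=\{z\in\mathbb C^m : (|z_1|^2,\dots,|z_m|^2)=A_Pp+b_P \text{ for some } p\in P\}$ with the coordinatewise action of $T^m$, let $K$ be the kernel of the epimorphism $\varLambda\colon T^m\to T^n$, and let $M=M(P,\varLambda)=\mathcal Z_P/K$ be the associated quasitoric manifold, with the action of $T^n\cong T^m/K$, the projection $\pi\colon M\to P$ induced by $z\mapsto p$, and the facial submanifolds $M_i=\pi^{-1}(F_i)$.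 Let $\rho_i=\mathcal Z_P\times_K\mathbb C_i$ be the complex line bundle over $M$ obtained from the $i$-th coordinate of $\mathbb C^m$, with $K$ acting diagonally and $T^n\cong T^m/K$ acting through the diagonal action of $T^m$. The tangent space of $M$ at $[z]$ is identified with the space of vectors tangent to $\mathcal Z_P$ at $z$ and orthogonal to the orbit $Kz$ in the real Euclidean space $\mathbb C^m$. The canonical $T^n$-equivariant stably complex structure is the isomorphism of real bundles $$c_\tau\colon \tau(M)\oplus\mathbb R^{2(m-n)}\longrightarrow\rho_1\oplus\dots\oplus\rho_m,\qquad ([z,h],\kappa,c)\longmapsto\bigl[z,\ h+(i\kappa_jz_j)_j+(c_jz_j)_j\bigr],$$ where $\mathbb R^{2(m-n)}$ stands for $\ker(\varLambda\colon\mathbb R^m\to\mathbb R^n)\oplus\ker(A_P^t\colon\mathbb R^m\to\mathbb R^n)$. The manifold $M$ is oriented by $\tau_{(p,1)}(M)\cong\tau_p(P)\oplus\tau_1(T^n)$ for $p$ in the interior of $P$, with the convention that $\partial/\partial p_1,\partial/\partial\theta_1,\dots,\partial/\partial p_n,\partial/\partial\theta_n$ is a positive frame, where $t_k=e^{i\theta_k}$;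 and $\mathbb R^{2(m-n)}$ is oriented so that $c_\tau$ preserves orientations, the sum of the $\rho_i$ being oriented by its complex structure. Each $t\in T^n$ acts on $\rho_1\oplus\dots\oplus\rho_m$ by $r(t)=c_\tau\circ(d(t\cdot)\oplus I)\circ c_\tau^{-1}$. At a fixed point $x$ of the $T^n$-action, $r$ restricts to a complex representation $r_x$ of $T^n$ on the fibre $\mathbb C^m$ of $\rho_1\oplus\dots\oplus\rho_m$. Split this fibre as $\mathbb C^n\oplus\mathbb C^{m-n}$, where $r_x$ has no trivial summand on $\mathbb C^n$ and is trivial on $\mathbb C^{m-n}$. The *sign* $\varsigma(x)$ is $+1$ if the composition $$\tau_x(M)\hookrightarrow\tau_x(M)\oplus\mathbb R^{2(m-n)}\xrightarrow{\ c_\tau\ }\mathbb C^n\oplus\mathbb C^{m-n}\to\mathbb C^n$$ respects the orientations, and $-1$ if it does not. The *weight vectors* $w_1(x),\dots,w_n(x)\in\mathbb Z^n$ are the exponents of the characters $t\mapsto t_1^{w_{k,1}}\cdots t_n^{w_{k,n}}$ into which the nontrivial summand $\mathbb C^n$ of $r_x$ decomposes. **Theorem.** Let $x$ be a fixed point of $M$.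 There are unique indices $j_1<\dots<j_n$ such that, for every $i$, $x\in M_i$ if and only if $i\in\{j_1,\dots,j_n\}$. Put $\varLambda_x=(\lambda_{j_1}\ \dots\ \lambda_{j_n})$. 1. For every real $n\times n$ matrix $N(P)_x$ whose $k$-th column is an inward pointing normal vector (of any length) to $F_{j_k}$, for $1\le k\le n$, $$\varsigma(x)=\operatorname{sign}\bigl(\det(\varLambda_x\,N(P)_x)\bigr).$$ 2. There is a unique integral $n\times n$ matrix $W_x$ with $W_x^t\varLambda_x=I_n$, and its columns are the weight vectors at $x$: the $k$-th column is the weight vector of the representation $r_x$ on the line $\rho_{j_k}|_x$, and a family of $n$ vectors is a family of weight vectors of $r_x$ if and only if it consists of the columns of $W_x$ in some order. -/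

import Mathlib

open Matrix

noncomputable section

/-- The intersection `{p | A p + b ≥ 0}` of `m` halfspaces in `ℝⁿ`. -/
def halfspaceIntersection {n m : ℕ} (A : Matrix (Fin m) (Fin n) ℝ) (b : Fin m → ℝ) :
    Set (Fin n → ℝ) :=
  {p | ∀ i, 0 ≤ (A *ᵥ p + b) i}

/-- A simple `n`-dimensional convex polytope in `ℝⁿ` with an ordered list of `m` facets, given as
the bounded intersection of `m` irredundant halfspaces. The rows of `A` are the inward pointing unit
normals to the facets, so that `p ↦ A p + b` is the vector of distances from the `m` bounding
hyperplanes. Simple: every vertex lies in exactly `n` facets. The polytope is oriented by the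
standard orientation of `ℝⁿ`. -/
structure SimplePolytope (n m : ℕ) where
  A : Matrix (Fin m) (Fin n) ℝ
  b : Fin m → ℝ
  unit_normal : ∀ i, ∑ k, A i k ^ 2 = 1
  bounded : Bornology.IsBounded (halfspaceIntersection A b)
  full_dimensional : (interior (halfspaceIntersection A b)).Nonempty
  irredundant : ∀ i, ∃ p, (A *ᵥ p + b) i < 0 ∧ ∀ j, j ≠ i → 0 ≤ (A *ᵥ p + b) j
  simple : ∀ v ∈ Set.extremePoints ℝ (halfspaceIntersection A b),
    {i | (A *ᵥ v + b) i = 0}.ncard = n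

namespace SimplePolytope

variable {n m : ℕ} (P : SimplePolytope n m)

/-- The affine map `i_P : ℝⁿ → ℝᵐ`. -/
def dist (p : Fin n → ℝ) : Fin m → ℝ := P.A *ᵥ p + P.b

/-- The underlying set of the polytope. -/
def body : Set (Fin n → ℝ) := halfspaceIntersection P.A P.b

/-- The facet `F_i`. -/
def facet (i : Fin m) : Set (Fin n → ℝ) := {p | p ∈ P.body ∧ P.dist p i = 0}

/-- The vertices. -/
def vertices : Set (Fin n → ℝ) := Set.extremePoints ℝ P.body

/-- `v` is an inward pointing normal vector (of any length) to the facet `F_i`. -/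
def IsInwardNormal (i : Fin m) (v : Fin n → ℝ) : Prop := ∃ c : ℝ, 0 < c ∧ v = c • P.A.row i

/-- The moment-angle manifold `Z_P ⊆ ℂᵐ`: the pullback of `i_P : P → ℝᵐ` along
`μ(z) = (|z₁|², …, |z_m|²)`. -/
def momentAngle : Set (Fin m → ℂ) :=
  {z | ∃ p ∈ P.body, ∀ i, Complex.normSq (z i) = P.dist p i}

/-- The tangent space at `z` of `Z_P`, as a real subspace of `ℂᵐ`. -/
def tangent (z : Fin m → ℂ) : Submodule ℝ (Fin m → ℂ) :=
  Submodule.span ℝ (tangentConeAt ℝ P.momentAngle z)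

end SimplePolytope

/-- A combinatorial quasitoric pair `(P, Λ)`. -/
structure QuasitoricPair (n m : ℕ) extends SimplePolytope n m where
  Λ : Matrix (Fin n) (Fin m) ℤ
  le : n ≤ m
  /-- The facets are finely ordered: the first `n` of them meet in the initial vertex. -/
  finely_ordered : ∃ v ∈ toSimplePolytope.vertices, ∀ k : Fin n,
    v ∈ toSimplePolytope.facet (Fin.castLE le k)
  /-- The first `n` columns of `Λ` form the identity matrix. -/
  refined : Λ.submatrix id (Fin.castLE le) = 1
  /-- Condition `(*)`. -/
  star : ∀ j : Fin n → Fin m, Function.Injective j →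
    (∃ v ∈ toSimplePolytope.vertices, ∀ k, v ∈ toSimplePolytope.facet (j k)) →
      (Λ.submatrix id j).det = 1 ∨ (Λ.submatrix id j).det = -1

/-- The character `t ↦ t₁^{w₁} ⋯ t_k^{w_k}` of the torus. -/
def torusChar {k : ℕ} (w : Fin k → ℤ) (t : Fin k → Circle) : Circle := ∏ i, t i ^ w i

/-- `v` is a positively oriented real frame of the complex vector space `V`, oriented by its
complex structure: real bases `b₁, i b₁, b₂, i b₂, …` with `b` a complex basis are positive. The
frame is indexed by `Fin 2 × ι`, where `(0, k)` and `(1, k)` correspond to `b_k` and `i b_k`. -/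
def IsPositiveFrame {ι V : Type*} [Fintype ι] [DecidableEq ι] [AddCommGroup V] [Module ℂ V]
    (v : Fin 2 × ι → V) : Prop :=
  ∃ b : Module.Basis ι ℂ V, 0 < (Complex.basisOneI.smulTower b).det v

namespace QuasitoricPair

variable {n m : ℕ} (Q : QuasitoricPair n m)

/-- The matrix `Λ` as a homomorphism `Tᵐ → Tⁿ`. -/
def torusHom : (Fin m → Circle) →* (Fin n → Circle) where
  toFun s := fun i => ∏ j, s j ^ Q.Λ i j
  map_one' := by ext; simp
  map_mul' s s' := by
    funext i
    simp [mul_zpow, Finset.prod_mul_distrib]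

/-- The kernel `K` of `Λ : Tᵐ → Tⁿ`. -/
def K : Subgroup (Fin m → Circle) := Q.torusHom.ker

/-- The section `t ↦ (t₁, …, t_n, 1, …, 1)` of `Λ : Tᵐ → Tⁿ`. -/
def lift (_Q : QuasitoricPair n m) : (Fin n → Circle) →* (Fin m → Circle) where
  toFun t := fun j => if h : (j : ℕ) < n then t ⟨j, h⟩ else 1
  map_one' := by ext; simp
  map_mul' t t' := by
    funext j
    by_cases h : (j : ℕ) < n <;> simp [h]

theorem torusHom_lift (t : Fin n → Circle) : Q.torusHom (Q.lift t) = t := by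
  funext i
  have h1 : ∀ k : Fin n, Q.Λ i (Fin.castLE Q.le k) = if i = k then 1 else 0 := fun k => by
    have := congrFun (congrFun Q.refined i) k
    simpa [Matrix.one_apply] using this
  show ∏ j, (Q.lift t j) ^ Q.Λ i j = t i
  have h2 : ∀ j : Fin m, j ∉ Set.range (Fin.castLE Q.le) → (Q.lift t j) ^ Q.Λ i j = 1 := by
    intro j hj
    have : ¬ (j : ℕ) < n := fun h => hj ⟨⟨j, h⟩, rfl⟩
    simp [lift, this]
  rw [← Fintype.prod_of_injective (Fin.castLE Q.le) (Fin.castLE_injective Q.le)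
    (fun k => (t k) ^ (if i = k then (1 : ℤ) else 0)) _ h2 (fun k => by
      rw [h1 k]; simp [lift])]
  rw [Finset.prod_eq_single i (fun k _ hk => by simp [Ne.symm hk]) (fun h => by simp at h)]
  simp

/-- The orbit space `X / K` of a `Tᵐ`-space. -/
def OrbitSpace (X : Type*) [MulAction (Fin m → Circle) X] : Type _ :=
  MulAction.orbitRel.Quotient Q.K X

/-- The class of a point in the orbit space. -/
def cls {X : Type*} [MulAction (Fin m → Circle) X] (z : X) : Q.OrbitSpace X :=
  Quotient.mk (MulAction.orbitRel Q.K X) z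

theorem cls_smul {X : Type*} [MulAction (Fin m → Circle) X] (k : Fin m → Circle) (hk : k ∈ Q.K)
    (z : X) : Q.cls (k • z) = Q.cls z :=
  Quotient.sound ((MulAction.orbitRel_apply).2 ⟨⟨k, hk⟩, rfl⟩)

theorem cls_eq_iff {X : Type*} [MulAction (Fin m → Circle) X] {z z' : X} :
    Q.cls z = Q.cls z' ↔ ∃ k ∈ Q.K, k • z' = z := by
  constructor
  · intro h
    obtain ⟨⟨k, hk⟩, h⟩ := (MulAction.orbitRel_apply).1 (Quotient.exact h)
    exact ⟨k, hk, h⟩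
  · rintro ⟨k, hk, rfl⟩
    exact Q.cls_smul k hk z'

/-- The action of `Tⁿ ≅ Tᵐ / K` on the orbit space: `t` acts through any `s ∈ Tᵐ` with
`Λ s = t`, see `smul_cls_eq`. -/
instance torusAction (X : Type*) [MulAction (Fin m → Circle) X] :
    MulAction (Fin n → Circle) (Q.OrbitSpace X) where
  smul t := Quotient.map (fun z => Q.lift t • z) (by
    intro z z' h
    obtain ⟨⟨k, hk⟩, h⟩ := (MulAction.orbitRel_apply).1 h
    refine (MulAction.orbitRel_apply).2 ⟨⟨k, hk⟩, ?_⟩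
    rw [← h]
    show k • Q.lift t • z' = Q.lift t • k • z'
    rw [smul_smul, smul_smul, mul_comm])
  one_smul x := by
    induction x using Quotient.inductionOn with
    | h z =>
      show Q.cls (Q.lift 1 • z) = Q.cls z
      rw [map_one, one_smul]
  mul_smul t t' x := by
    induction x using Quotient.inductionOn with
    | h z =>
      show Q.cls (Q.lift (t * t') • z) = Q.cls (Q.lift t • Q.lift t' • z)
      rw [map_mul, mul_smul]

theorem smul_cls {X : Type*} [MulAction (Fin m → Circle) X] (t : Fin n → Circle) (z : X) :
    t • Q.cls z = Q.cls (Q.lift t • z) := rfl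

theorem smul_cls_eq {X : Type*} [MulAction (Fin m → Circle) X] (s : Fin m → Circle) (z : X) :
    Q.torusHom s • Q.cls z = Q.cls (s • z) := by
  rw [smul_cls, cls_eq_iff]
  refine ⟨Q.lift (Q.torusHom s) * s⁻¹, ?_, ?_⟩
  · show Q.torusHom _ = 1
    rw [map_mul, torusHom_lift, map_inv, mul_inv_cancel]
  · rw [smul_smul, inv_mul_cancel_right]

/-- The moment-angle manifold as a type. -/
abbrev Z : Type := Q.momentAngle

theorem smul_mem_momentAngle (s : Fin m → Circle) {z : Fin m → ℂ} (hz : z ∈ Q.momentAngle) :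
    s • z ∈ Q.momentAngle := by
  obtain ⟨p, hp, h⟩ := hz
  refine ⟨p, hp, fun i => ?_⟩
  rw [← h i, Pi.smul_apply', Circle.smul_def, smul_eq_mul, Complex.normSq_mul,
    Circle.normSq_coe, one_mul]

/-- The coordinatewise action of `Tᵐ` on `Z_P`. -/
instance actionZ : MulAction (Fin m → Circle) Q.Z where
  smul s z := ⟨s • (z : Fin m → ℂ), Q.smul_mem_momentAngle s z.2⟩
  one_smul z := Subtype.ext (one_smul _ (z : Fin m → ℂ))
  mul_smul s s' z := Subtype.ext (mul_smul s s' (z : Fin m → ℂ))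

@[simp] theorem coe_smul_Z (s : Fin m → Circle) (z : Q.Z) :
    ((s • z : Q.Z) : Fin m → ℂ) = s • (z : Fin m → ℂ) := rfl

/-- The quasitoric manifold `M(P, Λ) = Z_P / K`, with its action of `Tⁿ`. -/
abbrev M : Type := Q.OrbitSpace Q.Z

/-- The facial submanifold `M_i`, the preimage of the facet `F_i` under the projection
`M → P` induced by `μ`. -/
def facial (i : Fin m) : Set Q.M :=
  {x | ∃ z : Q.Z, Q.cls z = x ∧
    ∃ p ∈ Q.facet i, ∀ l, Complex.normSq ((z : Fin m → ℂ) l) = Q.dist p l}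

/-- The Lie algebra of `K`: the kernel of `Λ : ℝᵐ → ℝⁿ`. -/
def lieK : Submodule ℝ (Fin m → ℝ) :=
  LinearMap.ker (Q.Λ.map (fun a : ℤ => (a : ℝ))).mulVecLin

/-- The linear forms on `ℝᵐ` that vanish on the directions of `i_P(ℝⁿ)`; each such `c` gives an
equation `∑ c_j (|z_j|² - b_j) = 0` of `Z_P`. -/
def conormal : Submodule ℝ (Fin m → ℝ) := LinearMap.ker (Q.Aᵀ).mulVecLin

/-- The real vector space of dimension `2(m-n)` that is the fibre of the trivial summand. -/
abbrev W : Type := Q.lieK × Q.conormal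

/-- The framing of the bundle `ξ` of tangents along the `K`-orbits by the infinitesimal action of
the Lie algebra of `K`: `κ ↦ (i κ_j z_j)_j`. -/
def orbitFraming (z : Fin m → ℂ) : Q.lieK →ₗ[ℝ] (Fin m → ℂ) where
  toFun κ := fun j => Complex.I * (κ.1 j : ℂ) * z j
  map_add' κ κ' := by funext j; simp; ring
  map_smul' r κ := by funext j; simp; ring

/-- The framing of the normal bundle of `Z_P` in `ℂᵐ` by the (half) gradients
`c ↦ (c_j z_j)_j` of the defining equations. -/
def normalFraming (z : Fin m → ℂ) : Q.conormal →ₗ[ℝ] (Fin m → ℂ) where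
  toFun c := fun j => (c.1 j : ℂ) * z j
  map_add' c c' := by funext j; simp; ring
  map_smul' r c := by funext j; simp; ring

/-- The tangent space of `M` at `[z]`, realised as the space of vectors tangent to `Z_P` at `z` and
orthogonal to the `K`-orbit of `z` in the real Euclidean space `ℂᵐ`. -/
def horizontal (z : Fin m → ℂ) : Submodule ℝ (Fin m → ℂ) where
  carrier := {v | v ∈ Q.tangent z ∧
    ∀ κ, ∑ j, (starRingEnd ℂ (Q.orbitFraming z κ j) * v j).re = 0}
  add_mem' {u v} hu hv := ⟨add_mem hu.1 hv.1, fun κ => by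
    have h1 := hu.2 κ
    have h2 := hv.2 κ
    simp only [Pi.add_apply, mul_add, Complex.add_re, Finset.sum_add_distrib, h1, h2, add_zero]⟩
  zero_mem' := ⟨zero_mem _, fun κ => by simp⟩
  smul_mem' r v hv := ⟨Submodule.smul_mem _ r hv.1, fun κ => by
    have h := hv.2 κ
    have : ∀ j, (starRingEnd ℂ (Q.orbitFraming z κ j) * (r • v) j).re
        = r * (starRingEnd ℂ (Q.orbitFraming z κ j) * v j).re := by
      intro j
      simp only [Pi.smul_apply, Complex.real_smul, Complex.mul_re, Complex.mul_im,
        Complex.ofReal_re, Complex.ofReal_im]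
      ring
    simp only [this, ← Finset.mul_sum, h, mul_zero]⟩

theorem smul_mem_tangent (s : Fin m → Circle) {z v : Fin m → ℂ} (hv : v ∈ Q.tangent z) :
    s • v ∈ Q.tangent (s • z) := by
  let L : (Fin m → ℂ) →L[ℝ] (Fin m → ℂ) :=
    LinearMap.toContinuousLinearMap
      { toFun := fun v => s • v
        map_add' := fun u v => by funext j; simp [Circle.smul_def]
        map_smul' := fun r v => by funext j; simp [Circle.smul_def]; ring }
  have hL : ∀ u, L u = s • u := fun u => rfl
  rw [← hL]
  refine Submodule.span_induction (p := fun v _ => L v ∈ Q.tangent (s • z)) ?_ ?_ ?_ ?_ hv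
  · intro u hu
    have h := (L.hasFDerivWithinAt (s := Q.momentAngle) (x := z)).mapsTo_tangent_cone hu
    refine Submodule.subset_span (tangentConeAt_mono ?_ h)
    rintro _ ⟨y, hy, rfl⟩
    exact Q.smul_mem_momentAngle s hy
  · rw [map_zero]; exact zero_mem _
  · intro a b _ _ ha hb
    rw [map_add]; exact add_mem ha hb
  · intro r a _ ha
    rw [map_smul]; exact Submodule.smul_mem _ r ha

theorem orbitFraming_smul (s : Fin m → Circle) (z : Fin m → ℂ) (κ : Q.lieK) :
    Q.orbitFraming (s • z) κ = s • Q.orbitFraming z κ := by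
  funext j
  simp [orbitFraming, Circle.smul_def]
  ring

theorem normalFraming_smul (s : Fin m → Circle) (z : Fin m → ℂ) (c : Q.conormal) :
    Q.normalFraming (s • z) c = s • Q.normalFraming z c := by
  funext j
  simp [normalFraming, Circle.smul_def]
  ring

theorem smul_mem_horizontal (s : Fin m → Circle) {z v : Fin m → ℂ} (hv : v ∈ Q.horizontal z) :
    s • v ∈ Q.horizontal (s • z) := by
  refine ⟨Q.smul_mem_tangent s hv.1, fun κ => ?_⟩
  rw [← hv.2 κ]
  refine Finset.sum_congr rfl fun j _ => ?_
  rw [orbitFraming_smul]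
  have h : starRingEnd ℂ (s j : ℂ) * (s j : ℂ) = 1 := by
    rw [mul_comm, Complex.mul_conj, Circle.normSq_coe, Complex.ofReal_one]
  simp only [Pi.smul_apply', Circle.smul_def, smul_eq_mul, map_mul]
  rw [mul_mul_mul_comm, h, one_mul]

/-- The pairs of a point of `Z_P` and a horizontal tangent vector. -/
abbrev HorizontalBundle : Type := {y : Q.Z × (Fin m → ℂ) // y.2 ∈ Q.horizontal y.1}

instance actionHorizontal : MulAction (Fin m → Circle) Q.HorizontalBundle where
  smul s y := ⟨s • y.1, Q.smul_mem_horizontal s y.2⟩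
  one_smul y := Subtype.ext (one_smul _ y.1)
  mul_smul s s' y := Subtype.ext (mul_smul s s' y.1)

/-- The tangent bundle `τ(M)`; the action of `t ∈ Tⁿ` on it is the differential `d(t·)`. -/
abbrev TM : Type := Q.OrbitSpace Q.HorizontalBundle

/-- The complex vector bundle `Z_P ×_K ℂᵐ = ρ₁ ⊕ ⋯ ⊕ ρ_m` over `M`. -/
abbrev Rho : Type := Q.OrbitSpace (Q.Z × (Fin m → ℂ))

/-- The stably complex structure, over the point `z` of `Z_P`. -/
def cTauAt (z : Fin m → ℂ) : Q.horizontal z × Q.W →ₗ[ℝ] (Fin m → ℂ) :=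
  (Q.horizontal z).subtype.coprod ((Q.orbitFraming z).coprod (Q.normalFraming z))

/-- The canonical stably complex structure `c_τ : τ(M) ⊕ ℝ^{2(m-n)} ≅ ρ₁ ⊕ ⋯ ⊕ ρ_m`. -/
def cTau (u : Q.TM × Q.W) : Q.Rho :=
  Quotient.map (fun y : Q.HorizontalBundle =>
      ((y.1.1, Q.cTauAt y.1.1 (⟨y.1.2, y.2⟩, u.2)) : Q.Z × (Fin m → ℂ))) (by
    intro y y' h
    obtain ⟨⟨k, hk⟩, h⟩ := (MulAction.orbitRel_apply).1 h
    refine (MulAction.orbitRel_apply).2 ⟨⟨k, hk⟩, ?_⟩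
    rw [← h]
    show (k • _ : Q.Z × (Fin m → ℂ)) = _
    refine Prod.ext rfl ?_
    show k • (y'.1.2 + (Q.orbitFraming y'.1.1 u.2.1 + Q.normalFraming y'.1.1 u.2.2)) =
      k • y'.1.2 + (Q.orbitFraming (k • (y'.1.1 : Fin m → ℂ)) u.2.1 +
        Q.normalFraming (k • (y'.1.1 : Fin m → ℂ)) u.2.2)
    rw [orbitFraming_smul, normalFraming_smul, smul_add, smul_add]) u.1

/-- The transformation `r(t) = c_τ ∘ (d(t·) ⊕ I) ∘ c_τ⁻¹` of `ρ₁ ⊕ ⋯ ⊕ ρ_m`. -/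
def r (t : Fin n → Circle) : Q.Rho → Q.Rho :=
  Function.extend Q.cTau (fun u => Q.cTau (t • u.1, u.2)) id

/-- The identification `v ↦ [z, v]` of `ℂᵐ` with the fibre of `ρ₁ ⊕ ⋯ ⊕ ρ_m` over `[z]`. -/
def fibre (z : Q.Z) (v : Fin m → ℂ) : Q.Rho := Q.cls (z, v)

/-- The trivial summand (the subspace of fixed vectors) of the representation of `Tⁿ` by `r` on the
fibre `ℂᵐ` over a fixed point `[z]`. -/
def trivialPart (z : Q.Z) : Submodule ℂ (Fin m → ℂ) :=
  Submodule.span ℂ {v | ∀ t, Q.r t (Q.fibre z v) = Q.fibre z v}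

/-- The points `(p, t)` of `P × Tⁿ`, `t = (e^{iθ₁}, …, e^{iθ_n})`, in `Z_P`; modulo `K` this is
`t` applied to the class of the nonnegative real point over `p`. -/
def coordinates (p θ : Fin n → ℝ) : Fin m → ℂ :=
  Q.lift (fun k => Circle.exp (θ k)) • fun j => (Real.sqrt (Q.dist p j) : ℂ)

/-- The frame of coordinate directions `∂/∂p_k` (index `(0, k)`) and `∂/∂θ_k` (index `(1, k)`) at
the point `(p, 1)` of `P × Tⁿ`, as tangent vectors of `Z_P`. -/
def interiorFrame (p : Fin n → ℝ) (α : Fin 2 × Fin n) : Fin m → ℂ :=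
  if α.1 = 0 then lineDeriv ℝ (fun q => Q.coordinates q 0) p (Pi.single α.2 1)
  else lineDeriv ℝ (fun θ => Q.coordinates p θ) 0 (Pi.single α.2 1)

/-- The images in `ℂᵐ` under `c_τ` of a family of tangent vectors of `M` at `[z]` and a family of
vectors of the trivial summand. -/
def stableFrame (z : Fin m → ℂ) (h : Fin 2 × Fin n → Q.horizontal z)
    (w : Fin 2 × Fin (m - n) → Q.W) : Fin 2 × (Fin n ⊕ Fin (m - n)) → (Fin m → ℂ)
  | (a, Sum.inl k) => Q.cTauAt z (h (a, k), 0)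
  | (a, Sum.inr l) => Q.cTauAt z (0, w (a, l))

/-- The orientation of the trivial summand `ℝ^{2(m-n)}`: a basis `w` is positive if `c_τ` matches
the orientation of `M` over the interior of `P` with the complex orientation of
`ρ₁ ⊕ ⋯ ⊕ ρ_m`. The orientation of `M` at `(p, 1)` is that of `τ_p(P) ⊕ τ_1(Tⁿ)`, given by the frame
`∂/∂p₁, ∂/∂θ₁, …, ∂/∂p_n, ∂/∂θ_n`; here `h` represents this frame modulo the tangents along the
`K`-orbit. -/
def IsPositiveTrivialBasis (w : Module.Basis (Fin 2 × Fin (m - n)) ℝ Q.W) : Prop :=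
  ∀ p ∈ interior Q.body, ∃ h : Fin 2 × Fin n → Q.horizontal (Q.coordinates p 0),
    (∀ α, Q.interiorFrame p α - (h α : Fin m → ℂ) ∈
      LinearMap.range (Q.orbitFraming (Q.coordinates p 0))) ∧
    IsPositiveFrame (Q.stableFrame (Q.coordinates p 0) h w)

/-- `h` is a positive basis of the tangent space of `M` at `[z]`, for the orientation of `M`
(the one induced by `c_τ`). -/
def IsPositiveTangentBasis (z : Fin m → ℂ)
    (h : Module.Basis (Fin 2 × Fin n) ℝ (Q.horizontal z)) : Prop :=
  ∃ w : Module.Basis (Fin 2 × Fin (m - n)) ℝ Q.W,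
    Q.IsPositiveTrivialBasis w ∧ IsPositiveFrame (Q.stableFrame z h w)

open Classical in
/-- The sign of a fixed point `x`: `+1` if the map `τ_x(M) → ℂᵐ → ℂⁿ` induced by `c_τ`, with `ℂⁿ`
the quotient of the fibre `ℂᵐ` by the trivial summand of the representation of `Tⁿ`, respects the
orientations, and `-1` otherwise. -/
def sign (x : Q.M) : ℤ :=
  if ∀ z : Q.Z, Q.cls z = x → ∀ h : Module.Basis (Fin 2 × Fin n) ℝ (Q.horizontal z),
      Q.IsPositiveTangentBasis z h →
        IsPositiveFrame (fun α => (Q.trivialPart z).mkQ (Q.cTauAt z (h α, 0)))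
  then 1 else -1

/-- The family `w` consists of the weight vectors of the representation of `Tⁿ` by `r` on the fibre
over the fixed point `x`: with respect to some complex basis of the fibre, `r(t)` is diagonal with
`n` entries given by the nontrivial characters with exponents `w_k` and the other `m - n` entries
equal to `1`. -/
def IsWeightFamily (x : Q.M) (w : Fin n → Fin n → ℤ) : Prop :=
  (∀ k, w k ≠ 0) ∧ ∀ z : Q.Z, Q.cls z = x →
    ∃ b : Module.Basis (Fin n ⊕ Fin (m - n)) ℂ (Fin m → ℂ),
      ∀ (t : Fin n → Circle) (c : Fin n → ℂ) (d : Fin (m - n) → ℂ),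
        Q.r t (Q.fibre z (∑ k, c k • b (Sum.inl k) + ∑ l, d l • b (Sum.inr l))) =
          Q.fibre z (∑ k, ((torusChar (w k) t : ℂ) * c k) • b (Sum.inl k) +
            ∑ l, d l • b (Sum.inr l))

/-- The representation of `Tⁿ` by `r` on the line `ρ_i|_x` over the fixed point `x` is the character
with weight vector `w`. -/
def IsWeightOfLine (x : Q.M) (i : Fin m) (w : Fin n → ℤ) : Prop :=
  ∀ z : Q.Z, Q.cls z = x → ∀ (t : Fin n → Circle) (c : ℂ),
    Q.r t (Q.fibre z (Pi.single i c)) = Q.fibre z (Pi.single i ((torusChar w t : ℂ) * c))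

/-- The submatrix of `Λ` formed by the columns `j₁, …, j_n`. -/
def minor (j : Fin n → Fin m) : Matrix (Fin n) (Fin n) ℤ := Q.Λ.submatrix id j

end QuasitoricPair

end

/-!
A point `[z]` of `M` over `p ∈ P` is fixed by `Tⁿ` exactly when the isotropy group of `z` in `Tᵐ`,
the coordinate subtorus of the facets through `p`, maps onto `Tⁿ` under `Λ`. These facets all pass
through some vertex, whose minor of `Λ` is invertible over `ℤ`; a missing facet would give a
nontrivial character that is trivial on `Tⁿ`. So the facets through `p` are the `n` facets through a
vertex (`QuasitoricPair.exists_splitting_of_fixed`). Let `I` be their set of indices, `A_I` the rows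
of `A_P` and `Λ_I` the columns of `Λ` with indices in `I`; both are invertible.

At such a point the tangent space of `M` is the coordinate subspace `ℂ^I`, and `c_τ` maps the
trivial summand isomorphically to the complementary one by `(κ, c) ↦ ((c_j + i κ_j) z_j)`
(`Over.mem_horizontal_iff`, `trivialEquiv`). An element `t` of `Tⁿ` acts on the fibre through the
element of `T^I` that `Λ_I` maps to `t`, so its weights are the columns of the inverse transpose of
`Λ_I` (`Over.r_fibre`). They are nonzero and distinct, hence every diagonalization of `r` has its
nontrivial weight lines on the coordinate lines of `I` (`exists_eq_weight`), and this determines the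
weight families.

As `c_τ` is compatible with the two splittings, the sign tells whether the isomorphism
`(κ, c) ↦ c_j + i κ_j`, `j ∉ I`, preserves orientations, where `ℝ^{2(m-n)}` is oriented through a
point `p` in the interior of `P`. There the stable frame consists of `∂/∂p_k`, which is real with
coordinates `A_{jk} / 2√d_j`, of `∂/∂θ_k`, which is `i √d_k e_k`, and of the vectors
`(c_j + i κ_j) √d_j`. Divide by `√d_j`, keep the coordinates off `I`, and replace those in `I` by
`Aᵀ x + i Λ y`. This real-linear map has a determinant of the sign of `det A_I * det Λ_I`. As
`Aᵀ c = 0` and `Λ κ = 0`, it makes the frame block triangular, with diagonal blocks of the positive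
definite matrix `Aᵀ D A`, of the identity, and of `(κ, c) ↦ c_j + i κ_j` off `I`
(`isPositiveFrame_interior_iff`). So the two orientations of `ℝ^{2(m-n)}` differ by the sign of
`det A_I * det Λ_I`, which is the assertion (`sign_eq`). An orientation of `ℝ^{2(m-n)}` can be
reversed unless this space is zero; since `P` is bounded, that happens only for `n = 0`
(`nonempty_inact`).
-/

noncomputable section

/-! ### Orientations of complex vector spaces -/

section PositiveFrames

variable {ι κ : Type*}

/-- The real and imaginary coordinates of a family of vectors of `ℂ^ι`, in the ordering of
coordinates that defines the complex orientation. -/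
def realMatrix (v : Fin 2 × ι → ι → ℂ) : Matrix (Fin 2 × ι) (Fin 2 × ι) ℝ :=
  Matrix.of fun β α => ![(v α β.2).re, (v α β.2).im] β.1

@[simp] theorem realMatrix_zero (v : Fin 2 × ι → ι → ℂ) (i : ι) (α : Fin 2 × ι) :
    realMatrix v (0, i) α = (v α i).re := rfl

@[simp] theorem realMatrix_one (v : Fin 2 × ι → ι → ℂ) (i : ι) (α : Fin 2 × ι) :
    realMatrix v (1, i) α = (v α i).im := rfl

/-- The frame `e_k, i e_k` of `ℂ^ι`. -/
def stdFrame [DecidableEq ι] (α : Fin 2 × ι) : ι → ℂ := Pi.single α.2 (![1, Complex.I] α.1)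

theorem realMatrix_stdFrame [DecidableEq ι] : realMatrix (stdFrame (ι := ι)) = 1 := by
  ext ⟨a, i⟩ ⟨a', i'⟩
  by_cases h : i = i'
  · subst h
    fin_cases a <;> fin_cases a' <;> simp [stdFrame, realMatrix]
  · fin_cases a <;> fin_cases a' <;> simp [stdFrame, realMatrix, h]

theorem re_stdFrame_zero [DecidableEq ι] (k : ι) :
    (fun i => (stdFrame ((0, k) : Fin 2 × ι) i).re) = Pi.single k 1 := by
  funext i
  by_cases h : i = k
  · subst h; simp [stdFrame]
  · simp [stdFrame, h]

theorem im_stdFrame_zero [DecidableEq ι] (k : ι) :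
    (fun i => (stdFrame ((0, k) : Fin 2 × ι) i).im) = 0 := by
  funext i
  by_cases h : i = k
  · subst h; simp [stdFrame]
  · simp [stdFrame, h]

theorem re_stdFrame_one [DecidableEq ι] (k : ι) :
    (fun i => (stdFrame ((1, k) : Fin 2 × ι) i).re) = 0 := by
  funext i
  by_cases h : i = k
  · subst h; simp [stdFrame]
  · simp [stdFrame, h]

theorem im_stdFrame_one [DecidableEq ι] (k : ι) :
    (fun i => (stdFrame ((1, k) : Fin 2 × ι) i).im) = Pi.single k 1 := by
  funext i
  by_cases h : i = k
  · subst h; simp [stdFrame]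
  · simp [stdFrame, h]

variable [Fintype ι] [DecidableEq ι] [Fintype κ]

/-- A complex-linear automorphism has positive determinant as a real-linear map: the determinant is
the squared modulus of the complex one. -/
theorem det_restrictScalars_real_pos {V : Type*} [AddCommGroup V] [Module ℂ V]
    [FiniteDimensional ℂ V] (f : V ≃ₗ[ℂ] V) :
    0 < LinearMap.det ((f : V →ₗ[ℂ] V).restrictScalars ℝ) := by
  rw [LinearMap.det_restrictScalars, Algebra.norm_complex_apply, Complex.normSq_pos]
  exact (LinearEquiv.isUnit_det' f).ne_zero

/-- The orientation of a complex vector space can be tested on any complex basis. -/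
theorem isPositiveFrame_iff_det_pos {V : Type*} [AddCommGroup V] [Module ℂ V]
    (b : Module.Basis ι ℂ V) (v : Fin 2 × ι → V) :
    IsPositiveFrame v ↔ 0 < (Complex.basisOneI.smulTower b).det v := by
  refine ⟨?_, fun h => ⟨b, h⟩⟩
  rintro ⟨b', h⟩
  have : FiniteDimensional ℂ V := b.finiteDimensional_of_finite
  let f : V ≃ₗ[ℂ] V := b.equiv b' (Equiv.refl ι)
  have hb : Complex.basisOneI.smulTower b' =
      (Complex.basisOneI.smulTower b).map (f.restrictScalars ℝ) := by
    refine Module.Basis.eq_of_apply_eq ?_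
    rintro ⟨a, i⟩
    simp [f, Module.Basis.smulTower_apply]
  rw [hb, Module.Basis.det_map] at h
  have h2 := (Complex.basisOneI.smulTower b).det_comp
    ((f.symm : V →ₗ[ℂ] V).restrictScalars ℝ) v
  have h3 : (⇑((f.symm : V →ₗ[ℂ] V).restrictScalars ℝ) ∘ v) =
      ⇑(f.restrictScalars ℝ).symm ∘ v := rfl
  rw [h3] at h2
  rw [h2] at h
  exact pos_of_mul_pos_right h (det_restrictScalars_real_pos f.symm).le

theorem IsPositiveFrame.map {V V' : Type*} [AddCommGroup V] [Module ℂ V]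
    [AddCommGroup V'] [Module ℂ V'] (f : V ≃ₗ[ℂ] V') {v : Fin 2 × ι → V} (hv : IsPositiveFrame v) :
    IsPositiveFrame (fun α => f (v α)) := by
  obtain ⟨b, h⟩ := hv
  refine ⟨b.map f, ?_⟩
  have hb : Complex.basisOneI.smulTower (b.map f) =
      (Complex.basisOneI.smulTower b).map (f.restrictScalars ℝ) := by
    refine Module.Basis.eq_of_apply_eq ?_
    rintro ⟨a, i⟩
    simp [Module.Basis.smulTower_apply]
  rw [hb, Module.Basis.det_map]
  convert h using 2
  funext α
  exact f.symm_apply_apply _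

theorem isPositiveFrame_comp_equiv {V V' : Type*} [AddCommGroup V] [Module ℂ V]
    [AddCommGroup V'] [Module ℂ V'] (f : V ≃ₗ[ℂ] V') (v : Fin 2 × ι → V) :
    IsPositiveFrame (fun α => f (v α)) ↔ IsPositiveFrame v :=
  ⟨fun h => by simpa using h.map f.symm, fun h => h.map f⟩

theorem isPositiveFrame_iff_realMatrix (v : Fin 2 × ι → ι → ℂ) :
    IsPositiveFrame v ↔ 0 < (realMatrix v).det := by
  rw [isPositiveFrame_iff_det_pos (Pi.basisFun ℂ ι), Module.Basis.det_apply]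
  have : (Complex.basisOneI.smulTower (Pi.basisFun ℂ ι)).toMatrix v = realMatrix v := by
    ext ⟨a, i⟩ α
    rw [Module.Basis.toMatrix_apply, Module.Basis.smulTower_repr_mk]
    simp [realMatrix, Complex.coe_basisOneI_repr]
  rw [this]

/-- The real-linear map `x + i y ↦ M x + i N y` has determinant `det M * det N`. -/
theorem det_realMatrix_map (M N : Matrix ι ι ℝ) (v : Fin 2 × ι → ι → ℂ) :
    (realMatrix fun α i => (⟨(M *ᵥ fun k => (v α k).re) i, (N *ᵥ fun k => (v α k).im) i⟩ : ℂ)).det =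
      M.det * N.det * (realMatrix v).det := by
  have h : (realMatrix fun α i =>
      (⟨(M *ᵥ fun k => (v α k).re) i, (N *ᵥ fun k => (v α k).im) i⟩ : ℂ)) =
      (Matrix.blockDiagonal ![M, N]).submatrix (Equiv.prodComm _ _) (Equiv.prodComm _ _) *
        realMatrix v := by
    ext ⟨a, i⟩ α
    rw [Matrix.mul_apply, Fintype.sum_prod_type]
    fin_cases a <;>
      simp [realMatrix, Matrix.blockDiagonal_apply, Matrix.mulVec, dotProduct]
  rw [h, Matrix.det_mul, Matrix.det_submatrix_equiv_self, Matrix.det_blockDiagonal,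
    Fin.prod_univ_two]
  rfl

/-- A frame of `ℂ^ι × ℂ^κ` whose second half lies in `ℂ^κ` has the product orientation. -/
theorem det_realMatrix_sum [DecidableEq κ] (v : Fin 2 × (ι ⊕ κ) → (ι ⊕ κ) → ℂ)
    (hv : ∀ a l i, v (a, Sum.inr l) (Sum.inl i) = 0) :
    (realMatrix v).det =
      (realMatrix fun α : Fin 2 × ι => fun i => v (α.1, Sum.inl α.2) (Sum.inl i)).det *
      (realMatrix fun α : Fin 2 × κ => fun i => v (α.1, Sum.inr α.2) (Sum.inr i)).det := by
  rw [← Matrix.det_submatrix_equiv_self (Equiv.prodSumDistrib (Fin 2) ι κ).symm,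
    ← Matrix.det_fromBlocks_zero₁₂ _ (Matrix.of fun (β : Fin 2 × κ) (α : Fin 2 × ι) =>
      realMatrix v (β.1, Sum.inr β.2) (α.1, Sum.inl α.2))]
  congr 1
  ext (⟨a, i⟩ | ⟨a, i⟩) (⟨a', i'⟩ | ⟨a', i'⟩)
  · rfl
  · fin_cases a <;> simp [hv]
  · rfl
  · rfl

theorem exists_basis_det_eq_one {V : Type*} [AddCommGroup V] [Module ℝ V] (f : V ≃ₗ[ℝ] (ι → ℂ)) :
    ∃ b : Module.Basis (Fin 2 × ι) ℝ V, (realMatrix fun α => f (b α)).det = 1 := by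
  refine ⟨(Complex.basisOneI.smulTower (Pi.basisFun ℂ ι)).map f.symm, ?_⟩
  rw [← Matrix.det_one (n := Fin 2 × ι), ← realMatrix_stdFrame]
  congr 2
  funext ⟨a, k⟩
  rw [Module.Basis.map_apply, LinearEquiv.apply_symm_apply, Module.Basis.smulTower_apply]
  funext i
  by_cases h : i = k
  · subst h; fin_cases a <;> simp [stdFrame]
  · fin_cases a <;> simp [stdFrame, h]

/-- Exchanging two vectors of a basis reverses the orientation, whatever identification with `ℂ^ι`
the orientation is measured by. -/
theorem exists_swap_basis {V : Type*} [AddCommGroup V] [Module ℝ V] [Nonempty ι]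
    (b : Module.Basis (Fin 2 × ι) ℝ V) : ∃ b' : Module.Basis (Fin 2 × ι) ℝ V,
      ∀ f : V → ι → ℂ,
        (realMatrix fun α => f (b' α)).det = -(realMatrix fun α => f (b α)).det := by
  obtain ⟨i⟩ := ‹Nonempty ι›
  let s : Equiv.Perm (Fin 2 × ι) := Equiv.swap (0, i) (1, i)
  refine ⟨b.reindex s, fun f => ?_⟩
  have : (realMatrix fun α => f (b.reindex s α)) =
      (realMatrix fun α => f (b α)).submatrix id s := by
    ext β α
    simp [realMatrix, s, Equiv.symm_swap]
  rw [this, Matrix.det_permute', Equiv.Perm.sign_swap (by simp)]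
  simp

/-- The kernel of a matrix with an invertible maximal minor is parametrized by the remaining
coordinates. -/
theorem exists_unique_ker_extension (M : Matrix ι (ι ⊕ κ) ℝ)
    (hM : (M.submatrix id Sum.inl).det ≠ 0) (y : κ → ℝ) :
    ∃! x : ι ⊕ κ → ℝ, M *ᵥ x = 0 ∧ ∀ l, x (Sum.inr l) = y l := by
  have hu : IsUnit (M.submatrix id Sum.inl).det := hM.isUnit
  have hs : ∀ x : ι ⊕ κ → ℝ, M *ᵥ x = M.submatrix id Sum.inl *ᵥ (x ∘ Sum.inl) +
      M.submatrix id Sum.inr *ᵥ (x ∘ Sum.inr) := by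
    intro x; ext i
    simp [Matrix.mulVec, dotProduct]
  refine ⟨Sum.elim (-((M.submatrix id Sum.inl)⁻¹ *ᵥ (M.submatrix id Sum.inr *ᵥ y))) y,
    ⟨?_, fun l => rfl⟩, ?_⟩
  · rw [hs, Sum.elim_comp_inl, Sum.elim_comp_inr, Matrix.mulVec_neg, Matrix.mulVec_mulVec,
      Matrix.mul_nonsing_inv _ hu, Matrix.one_mulVec, neg_add_cancel]
  · rintro x ⟨h1, h2⟩
    have h3 : x ∘ Sum.inr = y := funext h2
    rw [hs, h3] at h1
    have h4 : x ∘ Sum.inl = -((M.submatrix id Sum.inl)⁻¹ *ᵥ (M.submatrix id Sum.inr *ᵥ y)) := by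
      rw [← Matrix.mulVec_neg, ← eq_neg_of_add_eq_zero_left h1, Matrix.mulVec_mulVec,
        Matrix.nonsing_inv_mul _ hu, Matrix.one_mulVec]
    rw [← h3, ← h4, h3] at *
    rw [← h4, ← h3, Sum.elim_comp_inl_inr]

end PositiveFrames

/-! ### Faces of the polytope and tangents of the moment-angle manifold -/

namespace SimplePolytope

variable {n m : ℕ} (P : SimplePolytope n m)

theorem dist_add_smul (p d : Fin n → ℝ) (t : ℝ) (i : Fin m) :
    P.dist (p + t • d) i = P.dist p i + t * (P.A *ᵥ d) i := by
  simp only [dist, Matrix.mulVec_add, Matrix.mulVec_smul, Pi.add_apply, Pi.smul_apply, smul_eq_mul]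
  ring

theorem continuous_dist : Continuous P.dist := by
  unfold dist
  fun_prop

theorem isCompact_body : IsCompact P.body := by
  refine Metric.isCompact_of_isClosed_isBounded ?_ P.bounded
  have : P.body = ⋂ i, {p | 0 ≤ P.dist p i} := by
    ext p; simp [body, halfspaceIntersection, dist]
  rw [this]
  exact isClosed_iInter fun i =>
    isClosed_le continuous_const ((continuous_apply i).comp P.continuous_dist)

theorem eventually_dist_pos (p d : Fin n → ℝ) (i : Fin m) (hi : 0 < P.dist p i) :
    ∀ᶠ t : ℝ in nhds 0, 0 < P.dist (p + t • d) i := by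
  have hc : Continuous fun t : ℝ => P.dist (p + t • d) i :=
    (continuous_apply i).comp (P.continuous_dist.comp (by fun_prop))
  exact hc.continuousAt.eventually (lt_mem_nhds (by simpa using hi))

theorem dist_pos_of_mem_interior {p : Fin n → ℝ} (hp : p ∈ interior P.body) (i : Fin m) :
    0 < P.dist p i := by
  have hc : Continuous fun t : ℝ => p + t • (-P.A i) := by fun_prop
  have h1 : ∀ᶠ t : ℝ in nhds 0, p + t • (-P.A i) ∈ P.body :=
    hc.continuousAt.eventually (by simpa using mem_interior_iff_mem_nhds.1 hp)
  obtain ⟨t, ht, ht0⟩ := ((h1.filter_mono nhdsWithin_le_nhds).and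
    (self_mem_nhdsWithin (s := Set.Ioi (0 : ℝ)))).exists
  have h2 : 0 ≤ P.dist (p + t • (-P.A i)) i := ht i
  rw [dist_add_smul] at h2
  have h3 : (P.A *ᵥ (-P.A i)) i = -1 := by
    rw [Matrix.mulVec_neg, Pi.neg_apply, ← P.unit_normal i]
    simp [Matrix.mulVec, dotProduct, sq]
  rw [h3] at h2
  have : 0 < t := ht0
  linarith

/-- The normals of the facets through a vertex span `ℝⁿ`: a direction orthogonal to all of them
would move the vertex within the polytope both ways. -/
theorem det_normals_ne_zero {v : Fin n → ℝ} (hv : v ∈ P.vertices) (j : Fin n → Fin m)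
    (hj : ∀ i, P.dist v i = 0 → i ∈ Set.range j) : (P.A.submatrix j id).det ≠ 0 := by
  intro h0
  obtain ⟨d, hd0, hd⟩ := Matrix.exists_mulVec_eq_zero_iff.2 h0
  obtain ⟨hvb, hext⟩ := mem_extremePoints.1 hv
  have hA : ∀ k, (P.A *ᵥ d) (j k) = 0 := fun k => congrFun hd k
  have key : ∀ d' : Fin n → ℝ, (∀ k, (P.A *ᵥ d') (j k) = 0) →
      ∀ᶠ t : ℝ in nhds 0, v + t • d' ∈ P.body := by
    intro d' hd'
    have : ∀ᶠ t : ℝ in nhds 0, ∀ i, 0 ≤ P.dist (v + t • d') i := by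
      rw [Filter.eventually_all]
      intro i
      by_cases hi : P.dist v i = 0
      · obtain ⟨k, rfl⟩ := hj i hi
        exact Filter.Eventually.of_forall fun t => by
          rw [dist_add_smul, hi, hd' k, mul_zero, add_zero]
      · exact (P.eventually_dist_pos v d' i (lt_of_le_of_ne (hvb i) (Ne.symm hi))).mono
          fun t ht => ht.le
    exact this
  have h2 := (key d hA).and (key (-d) fun k => by
    rw [Matrix.mulVec_neg, Pi.neg_apply, hA k, neg_zero])
  obtain ⟨t, ⟨ht1, ht2⟩, ht0⟩ := ((h2.filter_mono nhdsWithin_le_nhds).and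
    (self_mem_nhdsWithin (s := Set.Ioi (0 : ℝ)))).exists
  have h3 := hext _ ht1 _ ht2 ⟨1/2, 1/2, by norm_num, by norm_num, by norm_num, by
    rw [smul_neg, smul_add, smul_add, add_add_add_comm, smul_neg, add_neg_cancel, add_zero,
      ← add_smul]; norm_num⟩
  have h4 : t • d = 0 := by simpa using h3.1
  rcases smul_eq_zero.1 h4 with h | h
  · exact (ne_of_gt ht0) h
  · exact hd0 h

/-- Every point of a polytope lies on a face with a vertex, which lies on at least the same
facets. -/
theorem exists_vertex_facets {p : Fin n → ℝ} (hp : p ∈ P.body) :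
    ∃ v ∈ P.vertices, ∀ i, P.dist p i = 0 → P.dist v i = 0 := by
  let F : Set (Fin n → ℝ) := {q | q ∈ P.body ∧ ∀ i, P.dist p i = 0 → P.dist q i = 0}
  have hF : F = P.body ∩ ⋂ i, {q | P.dist p i = 0 → P.dist q i = 0} := by
    ext q; simp [F]
  have hclosed : IsClosed (⋂ i, {q | P.dist p i = 0 → P.dist q i = 0}) := by
    refine isClosed_iInter fun i => ?_
    by_cases hi : P.dist p i = 0
    · simp only [hi, forall_const]
      exact isClosed_eq ((continuous_apply i).comp P.continuous_dist) continuous_const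
    · simp [hi]
  have hcompact : IsCompact F := hF ▸ P.isCompact_body.inter_right hclosed
  obtain ⟨v, hv⟩ := hcompact.extremePoints_nonempty ⟨p, hp, fun i h => h⟩
  have hex : IsExtreme ℝ P.body F := by
    refine ⟨fun q hq => hq.1, ?_⟩
    rintro x hx y hy q ⟨hq, hq0⟩ ⟨a, b, ha, hb, hab, rfl⟩
    have key : ∀ i, P.dist p i = 0 → P.dist x i = 0 := by
      intro i hi
      have h1 := hq0 i hi
      have h2 : P.dist (a • x + b • y) i = a * P.dist x i + b * P.dist y i := by
        simp only [dist, Matrix.mulVec_add, Matrix.mulVec_smul, Pi.add_apply, Pi.smul_apply,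
          smul_eq_mul]
        linear_combination (-P.b i) * hab
      have h3 : 0 ≤ P.dist x i := hx i
      have h4 : 0 ≤ P.dist y i := hy i
      have h5 := mul_nonneg ha.le h3
      have h6 := mul_nonneg hb.le h4
      have h7 : a * P.dist x i = 0 := by linarith
      exact (mul_eq_zero.1 h7).resolve_left ha.ne'
    exact ⟨hx, key⟩
  exact ⟨v, hex.extremePoints_subset_extremePoints hv, hv.1.2⟩

/-- The velocity of a curve in the moment-angle manifold is tangent to it. -/
theorem mem_tangent_of_curve {γ : ℝ → Fin m → ℂ} {v : Fin m → ℂ} (hγ : HasDerivAt γ v 0)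
    (hZ : ∀ᶠ t in nhds 0, γ t ∈ P.momentAngle) : v ∈ P.tangent (γ 0) := by
  refine Submodule.subset_span ?_
  have h1 := (hγ.hasFDerivAt.hasFDerivWithinAt
    (s := {t | γ t ∈ P.momentAngle})).mapsTo_tangent_cone
  have h2 : (1 : ℝ) ∈ tangentConeAt ℝ {t | γ t ∈ P.momentAngle} (0 : ℝ) := by
    rw [tangentConeAt_of_mem_nhds hZ]; trivial
  have h3 := h1 h2
  simp only [ContinuousLinearMap.toSpanSingleton_apply, one_smul] at h3
  exact tangentConeAt_mono (by rintro _ ⟨t, ht, rfl⟩; exact ht) h3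

/-- Differentiating the equations `∑ c_j (|z_j|² - b_j) = 0` of the moment-angle manifold. -/
theorem tangent_orthogonal {z v : Fin m → ℂ} (hv : v ∈ P.tangent z)
    {c : Fin m → ℝ} (hc : P.Aᵀ *ᵥ c = 0) :
    ∑ j, c j * ((z j).re * (v j).re + (z j).im * (v j).im) = 0 := by
  let g : (Fin m → ℂ) → ℝ := fun z => ∑ j, c j * ((z j).re * (z j).re + (z j).im * (z j).im)
  have hre : ∀ j, HasFDerivAt (fun z : Fin m → ℂ => (z j).re)
      (Complex.reCLM.comp (ContinuousLinearMap.proj (R := ℝ) (φ := fun _ => ℂ) j)) z := fun j =>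
    (Complex.reCLM.comp (ContinuousLinearMap.proj (R := ℝ) (φ := fun _ => ℂ) j)).hasFDerivAt
  have him : ∀ j, HasFDerivAt (fun z : Fin m → ℂ => (z j).im)
      (Complex.imCLM.comp (ContinuousLinearMap.proj (R := ℝ) (φ := fun _ => ℂ) j)) z := fun j =>
    (Complex.imCLM.comp (ContinuousLinearMap.proj (R := ℝ) (φ := fun _ => ℂ) j)).hasFDerivAt
  have hg : HasFDerivAt g _ z := HasFDerivAt.fun_sum (u := Finset.univ) fun j _ =>
    ((((hre j).mul (hre j)).add ((him j).mul (him j))).const_mul (c j))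
  have hconst : ∀ y ∈ P.momentAngle, g y = ∑ j, c j * P.b j := by
    rintro y ⟨p, hp, hy⟩
    have h1 : g y = c ⬝ᵥ (P.A *ᵥ p + P.b) :=
      Finset.sum_congr rfl fun j _ => by rw [← Complex.normSq_apply, hy j]; rfl
    rw [h1, dotProduct_add, Matrix.dotProduct_mulVec, ← Matrix.mulVec_transpose, hc,
      zero_dotProduct, zero_add]
    rfl
  refine Submodule.span_induction (p := fun v _ =>
    ∑ j, c j * ((z j).re * (v j).re + (z j).im * (v j).im) = 0) ?_ ?_ ?_ ?_ hv
  · intro u hu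
    have h1 := (hg.hasFDerivWithinAt (s := P.momentAngle)).mapsTo_tangent_cone hu
    have h2 : g '' P.momentAngle ⊆ {∑ j, c j * P.b j} := by
      rintro _ ⟨y, hy, rfl⟩; exact hconst y hy
    have h3 := tangentConeAt_subset_zero (𝕜 := ℝ) (fun hacc =>
      ((Set.Infinite.of_accPt hacc).mono h2) (Set.finite_singleton _)) h1
    have h4 : 2 * ∑ j, c j * ((z j).re * (u j).re + (z j).im * (u j).im) = 0 := by
      rw [Finset.mul_sum]
      refine Eq.trans ?_ h3
      simp only [_root_.sum_apply, _root_.add_apply,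
        _root_.smul_apply, ContinuousLinearMap.comp_apply,
        ContinuousLinearMap.proj_apply, Complex.reCLM_apply, Complex.imCLM_apply, smul_eq_mul]
      exact Finset.sum_congr rfl fun j _ => by ring
    linarith
  · simp
  · intro a b _ _ ha hb
    rw [← add_zero (0 : ℝ)]
    nth_rewrite 1 [← ha]
    rw [← hb, ← Finset.sum_add_distrib]
    exact Finset.sum_congr rfl fun j _ => by simp; ring
  · intro r a _ ha
    rw [← mul_zero r, ← ha, Finset.mul_sum]
    exact Finset.sum_congr rfl fun j _ => by simp; ring

end SimplePolytope

/-- A character of the torus determines its exponents. -/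
theorem torusChar_injective {k : ℕ} : Function.Injective (torusChar (k := k)) := by
  intro w w' h
  by_contra hne
  obtain ⟨i, hi⟩ := Function.ne_iff.1 hne
  have h1 : ∀ a : Circle, a ^ w i = a ^ w' i := by
    intro a
    have h2 := congrFun h (Pi.mulSingle i a)
    have h3 : ∀ u : Fin k → ℤ, torusChar u (Pi.mulSingle i a) = a ^ u i := by
      intro u
      rw [torusChar, Finset.prod_eq_single i]
      · simp
      · intro l _ hl
        simp [Pi.mulSingle_eq_of_ne hl]
      · simp
    rwa [h3, h3] at h2
  have hd : ((w i - w' i : ℤ) : ℝ) ≠ 0 := by exact_mod_cast sub_ne_zero.2 hi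
  -- An element of the circle whose power with the nonzero exponent `w i - w' i` is `-1`.
  have h2 := h1 (Circle.exp (Real.pi / ((w i - w' i : ℤ) : ℝ)))
  rw [← mul_inv_eq_one, ← _root_.zpow_neg, ← _root_.zpow_add, ← sub_eq_add_neg,
    ← Circle.exp_zsmul] at h2
  rw [zsmul_eq_mul, mul_div_cancel₀ _ hd] at h2
  have h3 := congrArg (fun a : Circle => (a : ℂ)) h2
  simp [Circle.coe_exp] at h3
  norm_num at h3

/-! ### The tangent space and the trivial summand over a vertex -/

namespace QuasitoricPair

variable {n m : ℕ} (Q : QuasitoricPair n m)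

/-- The matrix `Λ` with real entries. -/
def realΛ : Matrix (Fin n) (Fin m) ℝ := Q.Λ.map (fun a : ℤ => (a : ℝ))

/-- A splitting of the set of facets of `P` into the `n` facets through a vertex, which come first,
and the other `m - n` facets. Only the resulting invertibility of the two minors is recorded. -/
structure VertexSplitting where
  e : Fin n ⊕ Fin (m - n) ≃ Fin m
  det_normals : (Q.A.submatrix (e ∘ Sum.inl) id).det ≠ 0
  isUnit_minor : IsUnit (Q.minor (e ∘ Sum.inl)).det

namespace VertexSplitting

variable {Q} (S : Q.VertexSplitting)

/-- The index `j_k` of the `k`-th facet through the vertex. -/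
def act (k : Fin n) : Fin m := S.e (Sum.inl k)

/-- The index of the `l`-th facet that misses the vertex. -/
def inact (l : Fin (m - n)) : Fin m := S.e (Sum.inr l)

theorem act_injective : Function.Injective S.act :=
  S.e.injective.comp Sum.inl_injective

theorem inact_injective : Function.Injective S.inact :=
  S.e.injective.comp Sum.inr_injective

theorem act_ne_inact (k : Fin n) (l : Fin (m - n)) : S.act k ≠ S.inact l := fun h => by
  simpa using S.e.injective h

theorem forall_index {p : Fin m → Prop} : (∀ i, p i) ↔ (∀ k, p (S.act k)) ∧ ∀ l, p (S.inact l) := by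
  rw [← S.e.forall_congr_right, Sum.forall]
  rfl

theorem sum_index {M : Type*} [AddCommMonoid M] (f : Fin m → M) :
    ∑ i, f i = ∑ k, f (S.act k) + ∑ l, f (S.inact l) := by
  rw [← S.e.sum_comp, Fintype.sum_sum_type]
  rfl

/-- The point `z` of `Z_P` lies over the vertex: its vanishing coordinates are those of the facets
through the vertex. -/
def Over (z : Fin m → ℂ) : Prop :=
  z ∈ Q.momentAngle ∧ (∀ k, z (S.act k) = 0) ∧ ∀ l, z (S.inact l) ≠ 0

theorem det_realMinor_ne_zero : (Q.realΛ.submatrix id S.act).det ≠ 0 := by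
  have h : Q.realΛ.submatrix id S.act =
      (Q.minor (S.e ∘ Sum.inl)).map (Int.castRingHom ℝ) := rfl
  rw [h, ← RingHom.mapMatrix_apply, ← RingHom.map_det]
  exact (S.isUnit_minor.map _).ne_zero

theorem exists_unique_ker (M : Matrix (Fin n) (Fin m) ℝ) (hM : (M.submatrix id S.act).det ≠ 0)
    (y : Fin (m - n) → ℝ) : ∃! x : Fin m → ℝ, M *ᵥ x = 0 ∧ ∀ l, x (S.inact l) = y l := by
  obtain ⟨x, ⟨h1, h2⟩, h3⟩ := exists_unique_ker_extension (M.submatrix id S.e) hM y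
  refine ⟨x ∘ S.e.symm, ⟨?_, fun l => ?_⟩, ?_⟩
  · rw [← h1, Matrix.submatrix_mulVec_equiv]
    rfl
  · simpa [inact] using h2 l
  · rintro x' ⟨h4, h5⟩
    rw [← h3 (x' ∘ S.e) ⟨?_, h5⟩]
    · funext i; simp
    · rw [Matrix.submatrix_mulVec_equiv]
      funext i
      simpa [Function.comp_assoc] using congrFun h4 i

theorem det_transpose_normals_ne_zero : (Q.Aᵀ.submatrix id S.act).det ≠ 0 := by
  have := S.det_normals
  rwa [← Matrix.det_transpose] at this

/-- The Lie algebra of `K` is parametrized by the coordinates off the vertex. -/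
theorem exists_unique_lieK (y : Fin (m - n) → ℝ) :
    ∃! κ : Q.lieK, ∀ l, κ.1 (S.inact l) = y l := by
  obtain ⟨x, ⟨h1, h2⟩, h3⟩ := S.exists_unique_ker Q.realΛ S.det_realMinor_ne_zero y
  exact ⟨⟨x, h1⟩, h2, fun κ hκ => Subtype.ext (h3 κ.1 ⟨κ.2, hκ⟩)⟩

/-- The conormal vectors are parametrized by the coordinates off the vertex. -/
theorem exists_unique_conormal (y : Fin (m - n) → ℝ) :
    ∃! c : Q.conormal, ∀ l, c.1 (S.inact l) = y l := by
  obtain ⟨x, ⟨h1, h2⟩, h3⟩ := S.exists_unique_ker Q.Aᵀ S.det_transpose_normals_ne_zero y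
  exact ⟨⟨x, h1⟩, h2, fun κ hκ => Subtype.ext (h3 κ.1 ⟨κ.2, hκ⟩)⟩

/-- The isomorphism `(κ, c) ↦ (c_j + i κ_j)_j`, over the facets `F_j` that miss the vertex. -/
def trivialEquiv : Q.W ≃ₗ[ℝ] (Fin (m - n) → ℂ) :=
  LinearEquiv.ofBijective
    { toFun := fun w l => ⟨w.2.1 (S.inact l), w.1.1 (S.inact l)⟩
      map_add' := fun w w' => by funext l; apply Complex.ext <;> simp
      map_smul' := fun r w => by funext l; apply Complex.ext <;> simp } (by
    refine Function.bijective_iff_existsUnique _ |>.2 fun y => ?_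
    obtain ⟨κ, h1, h2⟩ := S.exists_unique_lieK fun l => (y l).im
    obtain ⟨c, h3, h4⟩ := S.exists_unique_conormal fun l => (y l).re
    refine ⟨(κ, c), funext fun l => Complex.ext (h3 l) (h1 l), ?_⟩
    rintro ⟨κ', c'⟩ h
    refine Prod.ext (h2 κ' fun l => ?_) (h4 c' fun l => ?_)
    · exact congrArg Complex.im (congrFun h l)
    · exact congrArg Complex.re (congrFun h l))

theorem trivialEquiv_apply (w : Q.W) (l : Fin (m - n)) :
    S.trivialEquiv w l = ⟨w.2.1 (S.inact l), w.1.1 (S.inact l)⟩ := rfl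

variable {S}

/-- Vectors supported on the vanishing coordinates are tangent: near the vertex the distances from
the facets through it can be prescribed, so these coordinates of `z` move freely. -/
theorem Over.mem_tangent {z : Fin m → ℂ} (hz : S.Over z) {v : Fin m → ℂ}
    (hv : ∀ l, v (S.inact l) = 0) : v ∈ Q.tangent z := by
  obtain ⟨⟨p, hp, hzp⟩, h0, h1⟩ := hz
  obtain ⟨d, hd⟩ : ∃ d : Fin n → ℝ, ∀ k, (Q.A *ᵥ d) (S.act k) = Complex.normSq (v (S.act k)) := by
    refine ⟨(Q.A.submatrix S.act id)⁻¹ *ᵥ fun k => Complex.normSq (v (S.act k)), fun k => ?_⟩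
    have h := Matrix.mulVec_mulVec (fun k => Complex.normSq (v (S.act k)))
      (Q.A.submatrix S.act id) (Q.A.submatrix S.act id)⁻¹
    have hu : IsUnit (Q.A.submatrix S.act id).det := S.det_normals.isUnit
    rw [Matrix.mul_nonsing_inv _ hu, Matrix.one_mulVec] at h
    exact congrFun h k
  have hdist0 : ∀ k, Q.dist p (S.act k) = 0 := fun k => by rw [← hzp, h0, map_zero]
  have hdist1 : ∀ l, 0 < Q.dist p (S.inact l) := fun l => by
    rw [← hzp]; exact Complex.normSq_pos.2 (h1 l)
  -- Off the vertex the modulus of the coordinates is corrected so as to stay in `Z_P`.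
  let γ : ℝ → Fin m → ℂ := fun t j => (t : ℂ) * v j +
    z j * ((Real.sqrt (Q.dist (p + t ^ 2 • d) j / Q.dist p j) : ℝ) : ℂ)
  have hγ0 : γ 0 = z := by
    funext j
    revert j
    rw [S.forall_index]
    refine ⟨fun k => by simp [γ, h0], fun l => ?_⟩
    simp [γ, div_self (hdist1 l).ne']
  have hγ : HasDerivAt γ v 0 := by
    rw [hasDerivAt_pi, S.forall_index]
    refine ⟨fun k => ?_, fun l => ?_⟩
    · simp only [γ, h0, zero_mul, add_zero]
      simpa using (Complex.ofRealCLM.hasDerivAt (x := (0 : ℝ))).mul_const (v (S.act k))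
    · simp only [γ, hv, mul_zero, zero_add]
      have h2 : HasDerivAt (fun t : ℝ => Q.dist (p + t ^ 2 • d) (S.inact l) /
          Q.dist p (S.inact l)) 0 0 := by
        simp only [Q.dist_add_smul]
        have := ((((hasDerivAt_id (0 : ℝ)).pow 2).mul_const
          ((Q.A *ᵥ d) (S.inact l))).const_add (Q.dist p (S.inact l))).div_const
          (Q.dist p (S.inact l))
        simpa using this
      have h3 := (h2.sqrt (by simp [(hdist1 l).ne'])).ofReal_comp.const_mul (z (S.inact l))
      simpa using h3
  rw [← hγ0]
  refine Q.mem_tangent_of_curve hγ ?_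
  have hev : ∀ᶠ t : ℝ in nhds 0, ∀ l, 0 < Q.dist (p + t ^ 2 • d) (S.inact l) := by
    rw [Filter.eventually_all]
    intro l
    have hc : Filter.Tendsto (fun t : ℝ => t ^ 2) (nhds 0) (nhds 0) := by
      simpa using (continuous_pow (M := ℝ) 2).tendsto 0
    exact hc.eventually (Q.eventually_dist_pos p d _ (hdist1 l))
  filter_upwards [hev] with t ht
  have hact : ∀ k, Q.dist (p + t ^ 2 • d) (S.act k) = Complex.normSq ((t : ℂ) * v (S.act k)) := by
    intro k
    rw [Q.dist_add_smul, hdist0, hd, Complex.normSq_mul, Complex.normSq_ofReal]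
    ring
  refine ⟨p + t ^ 2 • d, ?_, ?_⟩
  · show ∀ i, 0 ≤ Q.dist (p + t ^ 2 • d) i
    rw [S.forall_index]
    exact ⟨fun k => by rw [hact]; exact Complex.normSq_nonneg _, fun l => (ht l).le⟩
  · rw [S.forall_index]
    refine ⟨fun k => by rw [hact]; simp [γ, h0], fun l => ?_⟩
    simp only [γ, hv, mul_zero, zero_add, Complex.normSq_mul, Complex.normSq_ofReal, hzp]
    rw [Real.mul_self_sqrt (div_nonneg (ht l).le (hdist1 l).le), mul_div_cancel₀ _ (hdist1 l).ne']

/-- At a point over the vertex, the tangent space of `M` is the space of vectors supported on the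
vanishing coordinates. -/
theorem Over.mem_horizontal_iff {z : Fin m → ℂ} (hz : S.Over z) {v : Fin m → ℂ} :
    v ∈ Q.horizontal z ↔ ∀ l, v (S.inact l) = 0 := by
  constructor
  · rintro ⟨hv, ho⟩ l
    obtain ⟨c, hc, -⟩ := S.exists_unique_conormal (Pi.single l 1)
    obtain ⟨κ, hκ, -⟩ := S.exists_unique_lieK (Pi.single l 1)
    have h1 := Q.tangent_orthogonal hv (c := c.1) c.2
    have h2 := ho κ
    rw [S.sum_index, Finset.sum_eq_single_of_mem l (Finset.mem_univ l)
      (fun l' _ hl => by simp [hc, hl]), Finset.sum_eq_zero (fun k _ => by simp [hz.2.1])] at h1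
    rw [S.sum_index, Finset.sum_eq_single_of_mem l (Finset.mem_univ l)
      (fun l' _ hl => by simp [orbitFraming, hκ, hl]),
      Finset.sum_eq_zero (fun k _ => by simp [orbitFraming, hz.2.1])] at h2
    simp [hc] at h1
    simp [orbitFraming, hκ] at h2
    have h3 : starRingEnd ℂ (z (S.inact l)) * v (S.inact l) = 0 := by
      apply Complex.ext
      · simp; linarith
      · simp; linarith
    exact (mul_eq_zero.1 h3).resolve_left (by simpa using hz.2.2 l)
  · intro hv
    refine ⟨hz.mem_tangent hv, fun κ => ?_⟩
    rw [S.sum_index]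
    simp [orbitFraming, hz.2.1, hv]

theorem cTauAt_apply (z : Fin m → ℂ) (h : Q.horizontal z) (w : Q.W) (i : Fin m) :
    Q.cTauAt z (h, w) i = h.1 i + (⟨w.2.1 i, w.1.1 i⟩ : ℂ) * z i := by
  have : (⟨w.2.1 i, w.1.1 i⟩ : ℂ) = w.2.1 i + w.1.1 i * Complex.I := (Complex.mk_eq_add_mul_I _ _)
  rw [this]
  simp [cTauAt, orbitFraming, normalFraming]
  ring

theorem Over.cTauAt_act {z : Fin m → ℂ} (hz : S.Over z) (h : Q.horizontal z) (w : Q.W)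
    (k : Fin n) : Q.cTauAt z (h, w) (S.act k) = h.1 (S.act k) := by
  rw [cTauAt_apply, hz.2.1, mul_zero, add_zero]

theorem Over.cTauAt_inact {z : Fin m → ℂ} (hz : S.Over z) (h : Q.horizontal z) (w : Q.W)
    (l : Fin (m - n)) :
    Q.cTauAt z (h, w) (S.inact l) = S.trivialEquiv w l * z (S.inact l) := by
  rw [cTauAt_apply, hz.mem_horizontal_iff.1 h.2, zero_add, trivialEquiv_apply]

/-- At a point over the vertex, the tangent space of `M` is `ℂⁿ`. -/
def Over.horizontalEquiv {z : Fin m → ℂ} (hz : S.Over z) :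
    Q.horizontal z ≃ₗ[ℝ] (Fin n → ℂ) :=
  LinearEquiv.ofBijective
    { toFun := fun h k => h.1 (S.act k)
      map_add' := fun _ _ => rfl
      map_smul' := fun _ _ => rfl } (by
    constructor
    · intro h h' hh
      refine Subtype.ext (funext (S.forall_index.2 ⟨fun k => congrFun hh k, fun l => ?_⟩))
      rw [hz.mem_horizontal_iff.1 h.2, hz.mem_horizontal_iff.1 h'.2]
    · intro y
      refine ⟨⟨fun i => Sum.elim y 0 (S.e.symm i), hz.mem_horizontal_iff.2 fun l => ?_⟩, ?_⟩
      · simp [inact]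
      · funext k
        simp [act])

theorem Over.horizontalEquiv_apply {z : Fin m → ℂ} (hz : S.Over z) (h : Q.horizontal z)
    (k : Fin n) : hz.horizontalEquiv h k = h.1 (S.act k) := rfl

theorem Over.cTauAt_bijective {z : Fin m → ℂ} (hz : S.Over z) :
    Function.Bijective (Q.cTauAt z) := by
  constructor
  · rintro ⟨h, w⟩ ⟨h', w'⟩ hh
    refine Prod.ext (hz.horizontalEquiv.injective (funext fun k => ?_))
      (S.trivialEquiv.injective (funext fun l => ?_))
    · have := congrFun hh (S.act k)
      rwa [hz.cTauAt_act, hz.cTauAt_act] at this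
    · have := congrFun hh (S.inact l)
      rw [hz.cTauAt_inact, hz.cTauAt_inact] at this
      exact mul_right_cancel₀ (hz.2.2 l) this
  · intro y
    refine ⟨(hz.horizontalEquiv.symm fun k => y (S.act k),
      S.trivialEquiv.symm fun l => y (S.inact l) / z (S.inact l)),
      funext (S.forall_index.2 ⟨fun k => ?_, fun l => ?_⟩)⟩
    · rw [hz.cTauAt_act, ← hz.horizontalEquiv_apply, LinearEquiv.apply_symm_apply]
    · rw [hz.cTauAt_inact, LinearEquiv.apply_symm_apply, div_mul_cancel₀ _ (hz.2.2 l)]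

end VertexSplitting

end QuasitoricPair

/-! ### Fixed points lie over vertices -/

namespace QuasitoricPair

variable {n m : ℕ} (Q : QuasitoricPair n m)

theorem torusChar_torusHom (w : Fin n → ℤ) (s : Fin m → Circle) :
    torusChar w (Q.torusHom s) = ∏ j, s j ^ (w ᵥ* Q.Λ) j := by
  have h : ∀ i, Q.torusHom s i = ∏ j, s j ^ Q.Λ i j := fun i => rfl
  simp only [torusChar, h, ← Finset.prod_zpow, ← _root_.zpow_mul]
  rw [Finset.prod_comm]
  refine Finset.prod_congr rfl fun j _ => ?_
  have hsum : ∀ (T : Finset (Fin n)) (f : Fin n → ℤ), ∏ i ∈ T, s j ^ f i = s j ^ ∑ i ∈ T, f i := by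
    intro T f
    induction T using Finset.induction_on with
    | empty => simp
    | insert a T ha ih => rw [Finset.prod_insert ha, Finset.sum_insert ha, _root_.zpow_add, ih]
  rw [Matrix.vecMul, dotProduct, ← hsum]
  exact Finset.prod_congr rfl fun i _ => by rw [_root_.mul_comm]

/-- Over a fixed point, every element of `Tⁿ` lifts to an element of `Tᵐ` that fixes `z`. -/
theorem exists_stabilizer {z : Q.Z} (hz : ∀ t : Fin n → Circle, t • Q.cls z = Q.cls z)
    (t : Fin n → Circle) :
    ∃ s, Q.torusHom s = t ∧ s • z = z := by
  obtain ⟨k, hk, h⟩ := Q.cls_eq_iff.1 (hz t)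
  have h : k • z = Q.lift t • z := h
  refine ⟨k⁻¹ * Q.lift t, ?_, ?_⟩
  · have hk' : Q.torusHom k = 1 := hk
    rw [map_mul, map_inv, hk', torusHom_lift, inv_one, one_mul]
  · rw [mul_smul, ← h, inv_smul_smul]

theorem eq_one_of_smul_eq {s : Fin m → Circle} {z : Fin m → ℂ} (hs : s • z = z) {i : Fin m}
    (hi : z i ≠ 0) : s i = 1 := by
  have h := congrFun hs i
  rw [Pi.smul_apply', Circle.smul_def, smul_eq_mul] at h
  exact Circle.ext (mul_right_cancel₀ hi (h.trans (one_mul _).symm))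

namespace VertexSplitting

variable {Q} (S : Q.VertexSplitting)

/-- The matrix whose columns are the weight vectors at the vertex: the inverse transpose of the
minor of `Λ`. -/
def weights : Matrix (Fin n) (Fin n) ℤ := ((Q.minor S.act)⁻¹)ᵀ

theorem weights_transpose_mul : S.weightsᵀ * Q.minor S.act = 1 := by
  have h : IsUnit (Q.minor S.act).det := S.isUnit_minor
  rw [weights, Matrix.transpose_transpose, Matrix.nonsing_inv_mul _ h]

theorem weights_col_vecMul (k k' : Fin n) :
    (S.weights.col k ᵥ* Q.Λ) (S.act k') = if k = k' then 1 else 0 := by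
  have h := congrFun (congrFun S.weights_transpose_mul k) k'
  rw [Matrix.one_apply] at h
  exact h

theorem weights_col_injective : Function.Injective S.weights.col := by
  intro k k' h
  by_contra hne
  have h1 := S.weights_col_vecMul k k
  rw [h, S.weights_col_vecMul k' k, if_neg (Ne.symm hne)] at h1
  simp at h1

theorem weights_col_ne_zero (k : Fin n) : S.weights.col k ≠ 0 := by
  intro h
  have h1 := S.weights_col_vecMul k k
  rw [h] at h1
  simp at h1

/-- The characters with exponents in the columns of the weight matrix read off the coordinates of an
element of `Tᵐ` that is supported on the facets through the vertex. -/
theorem torusChar_weights {s : Fin m → Circle} (hs : ∀ l, s (S.inact l) = 1) (k : Fin n) :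
    torusChar (S.weights.col k) (Q.torusHom s) = s (S.act k) := by
  rw [torusChar_torusHom, ← S.e.prod_comp, Fintype.prod_sum_type]
  have h1 : ∀ l, s (S.e (Sum.inr l)) = 1 := hs
  simp only [h1, _root_.one_zpow, Finset.prod_const_one, mul_one]
  rw [Finset.prod_eq_single_of_mem k (Finset.mem_univ k)]
  · have := S.weights_col_vecMul k k
    rw [if_pos rfl] at this
    show s (S.act k) ^ (S.weights.col k ᵥ* Q.Λ) (S.act k) = _
    rw [this, zpow_one]
  · intro k' _ hk
    have := S.weights_col_vecMul k k'
    rw [if_neg (Ne.symm hk)] at this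
    show s (S.act k') ^ (S.weights.col k ᵥ* Q.Λ) (S.act k') = _
    rw [this, zpow_zero]

end VertexSplitting

/-- The facets through a vertex give a splitting. -/
theorem exists_splitting_of_vertex {v : Fin n → ℝ} (hv : v ∈ Q.vertices) :
    ∃ (j : Fin n ↪o Fin m) (S : Q.VertexSplitting), (∀ k, S.act k = j k) ∧
      ∀ l, Q.dist v (S.inact l) ≠ 0 := by
  classical
  let s : Finset (Fin m) := Finset.univ.filter fun i => Q.dist v i = 0
  have hs : s.card = n := by
    rw [← Q.simple v hv, ← Set.ncard_coe_finset]
    congr 1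
    ext i
    simp only [s, Finset.coe_filter, Finset.mem_univ, true_and]
    rfl
  have hs' : sᶜ.card = m - n := by rw [Finset.card_compl, hs, Fintype.card_fin]
  have hfac : ∀ k, v ∈ Q.facet (s.orderEmbOfFin hs k) := fun k =>
    ⟨hv.1, (Finset.mem_filter.1 (s.orderEmbOfFin_mem hs k)).2⟩
  have hcomp : finSumEquivOfFinset hs hs' ∘ Sum.inl = s.orderEmbOfFin hs :=
    funext fun k => finSumEquivOfFinset_inl hs hs' k
  refine ⟨s.orderEmbOfFin hs, ⟨finSumEquivOfFinset hs hs', ?_, ?_⟩, fun k => ?_, fun l => ?_⟩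
  · rw [hcomp]
    refine Q.det_normals_ne_zero hv _ fun i hi => ?_
    rw [Finset.range_orderEmbOfFin]
    simpa [s] using hi
  · rw [hcomp, Int.isUnit_iff]
    exact Q.star _ (s.orderEmbOfFin hs).injective ⟨v, hv, hfac⟩
  · exact congrFun hcomp k
  · have h : sᶜ.orderEmbOfFin hs' l ∈ sᶜ := Finset.orderEmbOfFin_mem _ _ _
    rw [Finset.mem_compl, Finset.mem_filter] at h
    exact fun h' => h ⟨Finset.mem_univ _, h'⟩

/-- A fixed point of `M` lies over a vertex: otherwise some coordinate of `Tⁿ`, in the basis given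
by `Λ` at a vertex of the face that contains the point, could not be reached by the isotropy
group. -/
theorem exists_splitting_of_fixed {x : Q.M} (hx : ∀ t : Fin n → Circle, t • x = x) :
    ∃ (j : Fin n ↪o Fin m) (S : Q.VertexSplitting), (∀ k, S.act k = j k) ∧
      (∃ z : Q.Z, Q.cls z = x) ∧ ∀ z : Q.Z, Q.cls z = x → S.Over z := by
  obtain ⟨z, rfl⟩ : ∃ z : Q.Z, Q.cls z = x := Quotient.exists_rep x
  obtain ⟨p, hp, hzp⟩ := z.2
  obtain ⟨v, hv, hpv⟩ := Q.exists_vertex_facets hp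
  obtain ⟨j, S, hS, hSv⟩ := Q.exists_splitting_of_vertex hv
  have h1 : ∀ l, (z : Fin m → ℂ) (S.inact l) ≠ 0 := fun l h =>
    hSv l (hpv _ (by rw [← hzp, h, map_zero]))
  have h0 : ∀ k, (z : Fin m → ℂ) (S.act k) = 0 := by
    intro k
    by_contra hk
    refine S.weights_col_ne_zero k (torusChar_injective (funext fun t => ?_))
    obtain ⟨s, rfl, hs⟩ := Q.exists_stabilizer hx t
    have hs' : s • (z : Fin m → ℂ) = z := congrArg Subtype.val hs
    rw [S.torusChar_weights (fun l => eq_one_of_smul_eq hs' (h1 l)), eq_one_of_smul_eq hs' hk]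
    simp [torusChar]
  refine ⟨j, S, hS, ⟨z, rfl⟩, fun z' hz' => ?_⟩
  obtain ⟨k, -, rfl⟩ := Q.cls_eq_iff.1 hz'
  refine ⟨(k • z).2, fun i => ?_, fun l => ?_⟩
  · rw [coe_smul_Z, Pi.smul_apply', h0, smul_zero]
  · rw [coe_smul_Z, Pi.smul_apply', Circle.smul_def, smul_eq_mul]
    exact mul_ne_zero (Circle.coe_ne_zero _) (h1 l)

theorem cls_mem_facial_iff (z : Q.Z) (i : Fin m) :
    Q.cls z ∈ Q.facial i ↔ (z : Fin m → ℂ) i = 0 := by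
  constructor
  · rintro ⟨z', hz', p, hp, h⟩
    obtain ⟨k, -, rfl⟩ := Q.cls_eq_iff.1 hz'
    have h1 := h i
    rw [hp.2, map_eq_zero, coe_smul_Z, Pi.smul_apply', Circle.smul_def, smul_eq_mul] at h1
    exact (mul_eq_zero.1 h1).resolve_left (Circle.coe_ne_zero _)
  · intro hi
    obtain ⟨p, hp, h⟩ := z.2
    exact ⟨z, rfl, p, ⟨hp, by rw [← h, hi, map_zero]⟩, h⟩

theorem VertexSplitting.Over.cls_mem_facial_iff {Q : QuasitoricPair n m} {S : Q.VertexSplitting}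
    {z : Q.Z} (hz : S.Over z) (i : Fin m) : Q.cls z ∈ Q.facial i ↔ i ∈ Set.range S.act := by
  rw [Q.cls_mem_facial_iff]
  revert i
  rw [S.forall_index]
  refine ⟨fun k => iff_of_true (hz.2.1 k) ⟨k, rfl⟩, fun l => iff_of_false (hz.2.2 l) ?_⟩
  rintro ⟨k, hk⟩
  exact S.act_ne_inact k l hk

end QuasitoricPair

/-! ### The stable frame over the interior of the polytope -/

namespace QuasitoricPair

variable {n m : ℕ} (Q : QuasitoricPair n m)

theorem coordinates_zero (p : Fin n → ℝ) (j : Fin m) :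
    Q.coordinates p 0 j = (Real.sqrt (Q.dist p j) : ℂ) := by
  have h : Q.lift (fun k => Circle.exp ((0 : Fin n → ℝ) k)) = 1 := by
    rw [← map_one Q.lift]
    congr 1
    funext k
    simp
  rw [coordinates, h, one_smul]

theorem realΛ_castLE (i k : Fin n) :
    Q.realΛ i (Fin.castLE Q.le k) = if i = k then 1 else 0 := by
  have := congrFun (congrFun Q.refined i) k
  simp only [Matrix.submatrix_apply, id, Matrix.one_apply] at this
  rw [realΛ, Matrix.map_apply, this]
  split_ifs <;> simp

theorem coordinates_mem {p : Fin n → ℝ} (hp : p ∈ Q.body) (s : Fin m → Circle) :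
    (s • fun j => (Real.sqrt (Q.dist p j) : ℂ)) ∈ Q.momentAngle := by
  refine Q.smul_mem_momentAngle s ⟨p, hp, fun i => ?_⟩
  rw [Complex.normSq_ofReal]
  exact Real.mul_self_sqrt (hp i)

section Interior

variable {p : Fin n → ℝ}

theorem hasDerivAt_coordinates_point (hp : ∀ j, 0 < Q.dist p j) (k : Fin n) :
    HasDerivAt (fun t : ℝ => Q.coordinates (p + t • Pi.single k 1) 0)
      (fun j => ((Q.A j k / (2 * Real.sqrt (Q.dist p j)) : ℝ) : ℂ)) 0 := by
  rw [hasDerivAt_pi]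
  intro j
  simp only [coordinates_zero, Q.dist_add_smul]
  have h1 : HasDerivAt (fun t : ℝ => Q.dist p j + t * (Q.A *ᵥ Pi.single k 1) j) (Q.A j k) 0 := by
    have := ((hasDerivAt_id (0 : ℝ)).mul_const ((Q.A *ᵥ Pi.single k 1) j)).const_add (Q.dist p j)
    simpa using this
  have h2 := (h1.sqrt (by simpa using (hp j).ne')).ofReal_comp
  simpa using h2

theorem interiorFrame_point (hp : ∀ j, 0 < Q.dist p j) (k : Fin n) (j : Fin m) :
    Q.interiorFrame p (0, k) j = ((Q.A j k / (2 * Real.sqrt (Q.dist p j)) : ℝ) : ℂ) := by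
  have h := (Q.hasDerivAt_coordinates_point hp k).deriv
  rw [interiorFrame, if_pos rfl, lineDeriv]
  exact congrFun h j

theorem interiorFrame_angle (k : Fin n) (j : Fin m) :
    Q.interiorFrame p (1, k) j =
      if j = Fin.castLE Q.le k then Complex.I * Real.sqrt (Q.dist p j) else 0 := by
  rw [interiorFrame, if_neg (by simp), lineDeriv]
  have h : HasDerivAt (fun t : ℝ => Q.coordinates p (0 + t • Pi.single k 1))
      (fun j => if j = Fin.castLE Q.le k then Complex.I * Real.sqrt (Q.dist p j) else 0) 0 := by
    rw [hasDerivAt_pi]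
    intro j
    by_cases hj : j = Fin.castLE Q.le k
    · subst hj
      have h1 : ∀ t : ℝ, Q.coordinates p (0 + t • Pi.single k 1) (Fin.castLE Q.le k) =
          Complex.exp (t * Complex.I) * Real.sqrt (Q.dist p (Fin.castLE Q.le k)) := by
        intro t
        simp [coordinates, lift, Circle.smul_def, Circle.coe_exp]
      simp only [h1, if_true]
      have h2 := (((Complex.ofRealCLM.hasDerivAt (x := (0 : ℝ))).mul_const
        Complex.I).cexp).mul_const (Real.sqrt (Q.dist p (Fin.castLE Q.le k)) : ℂ)
      simpa using h2
    · have h1 : ∀ t : ℝ, Q.coordinates p (0 + t • Pi.single k 1) j =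
          Real.sqrt (Q.dist p j) := by
        intro t
        rw [coordinates, Pi.smul_apply', Circle.smul_def, smul_eq_mul]
        convert one_mul _
        by_cases hjn : (j : ℕ) < n
        · have hne : (⟨j, hjn⟩ : Fin n) ≠ k := fun h => hj (by subst h; rfl)
          simp [lift, hjn, hne]
        · simp [lift, hjn]
      simp only [h1, if_neg hj]
      exact hasDerivAt_const _ _
  exact congrFun h.deriv j

theorem mulVec_injective_normals (S : Q.VertexSplitting) : Function.Injective Q.A.mulVec := by
  intro x y hxy
  refine Matrix.mulVec_injective_of_isUnit
    ((Matrix.isUnit_iff_isUnit_det _).2 S.det_normals.isUnit) (funext fun k => ?_)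
  exact congrFun hxy (S.act k)

theorem vecMul_injective_realΛ : Function.Injective Q.realΛ.vecMul := by
  intro x y hxy
  funext k
  have h := congrFun hxy (Fin.castLE Q.le k)
  simpa [Matrix.vecMul, dotProduct, realΛ_castLE] using h

/-- The coordinate frame of `P × Tⁿ` can be corrected by vectors tangent to the `K`-orbit so as to
become horizontal. -/
theorem exists_horizontal_frame (hp : p ∈ interior Q.body) :
    ∃ h : Fin 2 × Fin n → Q.horizontal (Q.coordinates p 0),
      ∀ α, Q.interiorFrame p α - (h α : Fin m → ℂ) ∈
        LinearMap.range (Q.orbitFraming (Q.coordinates p 0)) := by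
  have hd := Q.dist_pos_of_mem_interior hp
  have hpt : ∀ k, Q.interiorFrame p (0, k) ∈ Q.horizontal (Q.coordinates p 0) := by
    intro k
    refine ⟨?_, fun κ => ?_⟩
    · have h1 := Q.hasDerivAt_coordinates_point hd k
      have h2 : Q.interiorFrame p (0, k) = _ := funext (Q.interiorFrame_point hd k)
      rw [h2]
      have h3 := Q.mem_tangent_of_curve h1 (by
        have hc : Continuous fun t : ℝ => p + t • (Pi.single k 1 : Fin n → ℝ) := by fun_prop
        have : ∀ᶠ t : ℝ in nhds 0, p + t • (Pi.single k 1 : Fin n → ℝ) ∈ Q.body :=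
          hc.continuousAt.eventually (by simpa using mem_interior_iff_mem_nhds.1 hp)
        filter_upwards [this] with t ht
        exact Q.coordinates_mem ht _)
      simpa using h3
    · refine Finset.sum_eq_zero fun j _ => ?_
      rw [Q.interiorFrame_point hd, orbitFraming, LinearMap.coe_mk, AddHom.coe_mk, coordinates_zero,
        Complex.mul_re, Complex.ofReal_im, mul_zero, sub_zero]
      simp
  -- The correction of `∂/∂θ_k` is orthogonal projection, for the metric with weights `|z_j|²`.
  have hang : ∀ k, ∃ h : Q.horizontal (Q.coordinates p 0), Q.interiorFrame p (1, k) - h.1 ∈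
      LinearMap.range (Q.orbitFraming (Q.coordinates p 0)) := by
    intro k
    have hG : IsUnit (Q.realΛ * diagonal (fun j => (Q.dist p j)⁻¹) * Q.realΛᵀ).det := by
      have := (Matrix.PosDef.diagonal (R := ℝ) fun j =>
        inv_pos.2 (hd j)).mul_mul_conjTranspose_same Q.vecMul_injective_realΛ
      exact this.det_pos.ne'.isUnit
    let u : Fin n → ℝ := (Q.realΛ * diagonal (fun j => (Q.dist p j)⁻¹) * Q.realΛᵀ)⁻¹ *ᵥ
      Pi.single k 1
    let y : Fin m → ℝ := fun j => (Q.dist p j)⁻¹ * (Q.realΛᵀ *ᵥ u) j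
    have hy : Q.realΛ *ᵥ y = Pi.single k 1 := by
      have h1 : y = diagonal (fun j => (Q.dist p j)⁻¹) *ᵥ (Q.realΛᵀ *ᵥ u) :=
        funext fun j => by rw [Matrix.mulVec_diagonal]
      rw [h1, Matrix.mulVec_mulVec, Matrix.mulVec_mulVec, show u = _ from rfl,
        Matrix.mulVec_mulVec, Matrix.mul_nonsing_inv _ hG, Matrix.one_mulVec]
    have hperp : ∀ κ : Q.lieK, ∑ j, κ.1 j * (Q.dist p j * y j) = 0 := by
      intro κ
      have h1 : Q.realΛ *ᵥ κ.1 = 0 := κ.2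
      have h2 : ∀ j, Q.dist p j * y j = (Q.realΛᵀ *ᵥ u) j := fun j =>
        mul_inv_cancel_left₀ (hd j).ne' _
      simp only [h2]
      show κ.1 ⬝ᵥ (Q.realΛᵀ *ᵥ u) = 0
      rw [Matrix.dotProduct_mulVec, Matrix.vecMul_transpose, h1, zero_dotProduct]
    refine ⟨⟨fun j => Complex.I * y j * Q.coordinates p 0 j, ?_, fun κ => ?_⟩, ?_⟩
    · have hγ : HasDerivAt (fun (t : ℝ) (j : Fin m) =>
          Complex.exp (t * (Complex.I * y j)) * Q.coordinates p 0 j)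
          (fun j => Complex.I * y j * Q.coordinates p 0 j) 0 := by
        rw [hasDerivAt_pi]
        intro j
        have h2 := (((Complex.ofRealCLM.hasDerivAt (x := (0 : ℝ))).mul_const
          (Complex.I * y j)).cexp).mul_const (Q.coordinates p 0 j)
        simpa using h2
      have h3 := Q.mem_tangent_of_curve hγ (Filter.Eventually.of_forall fun t => by
        convert Q.coordinates_mem (interior_subset hp) (fun j => Circle.exp (t * y j)) using 1
        funext j
        rw [Pi.smul_apply', Circle.smul_def, smul_eq_mul, Circle.coe_exp, coordinates_zero]
        congr 2
        push_cast
        ring)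
      simpa using h3
    · rw [← hperp κ]
      refine Finset.sum_congr rfl fun j _ => ?_
      have h1 : Real.sqrt (Q.dist p j) * Real.sqrt (Q.dist p j) = Q.dist p j :=
        Real.mul_self_sqrt (hd j).le
      simp [orbitFraming, coordinates_zero]
      linear_combination (κ.1 j * y j) * h1
    · refine ⟨⟨fun j => (Pi.single (Fin.castLE Q.le k) 1 : Fin m → ℝ) j - y j, ?_⟩, ?_⟩
      · show Q.realΛ *ᵥ ((Pi.single (Fin.castLE Q.le k) 1 : Fin m → ℝ) - y) = 0
        rw [Matrix.mulVec_sub, hy, Matrix.mulVec_single_one]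
        funext i
        simp [realΛ_castLE, Pi.single_apply]
      · funext j
        simp only [orbitFraming, LinearMap.coe_mk, AddHom.coe_mk, Pi.sub_apply,
          interiorFrame_angle, coordinates_zero]
        by_cases hj : j = Fin.castLE Q.le k
        · subst hj; simp; ring
        · simp [hj]
  choose g hg using hang
  refine ⟨fun α => if α.1 = 0 then ⟨_, hpt α.2⟩ else g α.2, ?_⟩
  rintro ⟨a, k⟩
  fin_cases a
  · simp
  · simpa using hg k

end Interior

namespace VertexSplitting

variable {Q} (S : Q.VertexSplitting)

/-- The square matrix formed by `M` and, below it, the coordinates of the facets that miss the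
vertex, applied after division by the positive coordinates `√d_j` of the point. -/
def completion (M : Matrix (Fin n) (Fin m) ℝ) (d : Fin m → ℝ) :
    Matrix (Fin n ⊕ Fin (m - n)) (Fin n ⊕ Fin (m - n)) ℝ :=
  fromBlocks (M.submatrix id S.act) (M.submatrix id S.inact) 0 1 *
    diagonal fun i => (Real.sqrt (d (S.e i)))⁻¹

theorem det_completion (M : Matrix (Fin n) (Fin m) ℝ) (d : Fin m → ℝ) :
    (S.completion M d).det = (M.submatrix id S.act).det * ∏ i, (Real.sqrt (d (S.e i)))⁻¹ := by
  rw [completion, Matrix.det_mul, Matrix.det_fromBlocks_zero₂₁, Matrix.det_one, mul_one,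
    Matrix.det_diagonal]

theorem completion_mulVec (M : Matrix (Fin n) (Fin m) ℝ) (d : Fin m → ℝ) (x : Fin m → ℝ) :
    S.completion M d *ᵥ (fun i => x (S.e i)) =
      Sum.elim (M *ᵥ fun j => (Real.sqrt (d j))⁻¹ * x j)
        (fun l => (Real.sqrt (d (S.inact l)))⁻¹ * x (S.inact l)) := by
  rw [completion, ← Matrix.mulVec_mulVec]
  have h : (diagonal fun i => (Real.sqrt (d (S.e i)))⁻¹) *ᵥ (fun i => x (S.e i)) =
      fun i => (Real.sqrt (d (S.e i)))⁻¹ * x (S.e i) :=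
    funext fun i => Matrix.mulVec_diagonal _ _ _
  rw [h, Matrix.fromBlocks_mulVec]
  congr 1
  · funext k
    simp only [Pi.add_apply, Matrix.mulVec, dotProduct]
    rw [S.sum_index]
    rfl
  · rw [Matrix.zero_mulVec, zero_add, Matrix.one_mulVec]
    rfl

/-- Over the interior of `P`, the stable frame is compared with its trivial part at the vertex: the
real parts are mapped by `Aᵀ`, which kills the conormal vectors, the imaginary parts by `Λ`, which
kills the Lie algebra of `K`, so that the frame becomes block triangular. -/
theorem isPositiveFrame_interior_iff {p : Fin n → ℝ} (hd : ∀ j, 0 < Q.dist p j)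
    (h : Fin 2 × Fin n → Q.horizontal (Q.coordinates p 0))
    (hh : ∀ α, Q.interiorFrame p α - (h α : Fin m → ℂ) ∈
      LinearMap.range (Q.orbitFraming (Q.coordinates p 0)))
    (w : Fin 2 × Fin (m - n) → Q.W) :
    IsPositiveFrame (Q.stableFrame (Q.coordinates p 0) h w) ↔
      0 < (Q.A.submatrix S.act id).det * (Q.realΛ.submatrix id S.act).det *
        (realMatrix fun α => S.trivialEquiv (w α)).det := by
  let s : Fin m → ℝ := fun j => Real.sqrt (Q.dist p j)
  have hs : ∀ j, 0 < s j := fun j => Real.sqrt_pos.2 (hd j)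
  let v : Fin 2 × (Fin n ⊕ Fin (m - n)) → (Fin n ⊕ Fin (m - n)) → ℂ :=
    fun α i => Q.stableFrame (Q.coordinates p 0) h w α (S.e i)
  have h0 : IsPositiveFrame (Q.stableFrame (Q.coordinates p 0) h w) ↔ 0 < (realMatrix v).det := by
    rw [← isPositiveFrame_iff_realMatrix]
    exact (isPositiveFrame_comp_equiv (LinearEquiv.funCongrLeft ℂ ℂ S.e) _).symm
  have hdet := det_realMatrix_map (S.completion Q.Aᵀ (Q.dist p)) (S.completion Q.realΛ (Q.dist p)) v
  -- Up to tangents `i κ z` along the `K`-orbit, the frame has real and imaginary parts that are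
  -- explicit multiples of the coordinates `s_j` of the point.
  have hinr : ∀ a l, (∀ i, (v (a, Sum.inr l) i).re = (w (a, l)).2.1 (S.e i) * s (S.e i)) ∧
      ∀ i, (v (a, Sum.inr l) i).im = (w (a, l)).1.1 (S.e i) * s (S.e i) := by
    intro a l
    constructor <;> intro i <;>
      simp [v, stableFrame, cTauAt_apply, coordinates_zero, s]
  have hinl : ∀ a k, ∃ κ : Q.lieK, (∀ i, (v (a, Sum.inl k) i).re =
        (Q.interiorFrame p (a, k) (S.e i)).re) ∧
      ∀ i, (v (a, Sum.inl k) i).im =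
        (Q.interiorFrame p (a, k) (S.e i)).im - κ.1 (S.e i) * s (S.e i) := by
    intro a k
    obtain ⟨κ, hκ⟩ := hh (a, k)
    have h1 : ∀ j, (h (a, k)).1 j = Q.interiorFrame p (a, k) j -
        Q.orbitFraming (Q.coordinates p 0) κ j := by
      intro j
      rw [hκ]
      simp
    refine ⟨κ, fun i => ?_, fun i => ?_⟩ <;>
      simp [v, stableFrame, cTauAt_apply, h1, orbitFraming, coordinates_zero, s]
  have hcancel : ∀ (x : Fin m → ℝ), (fun j => (s j)⁻¹ * (x j * s j)) = x := fun x =>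
    funext fun j => by rw [mul_comm (x j), inv_mul_cancel_left₀ (hs j).ne']
  let G : Matrix (Fin n) (Fin n) ℝ := Q.Aᵀ * diagonal (fun j => (2 * Q.dist p j)⁻¹) * Q.A
  have hG : 0 < G.det := ((Matrix.PosDef.diagonal (R := ℝ) fun j =>
    inv_pos.2 (mul_pos two_pos (hd j))).conjTranspose_mul_mul_same
      (Q.mulVec_injective_normals S)).det_pos
  -- After the transformation the trivial part has coordinates only off the vertex, and there it
  -- is `c + i κ`, independently of the point; the tangent part has coordinates `G` and `1` at the
  -- vertex.
  have hre : ∀ α, (S.completion Q.Aᵀ (Q.dist p) *ᵥ fun i => (v α i).re) =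
      Sum.elim (Q.Aᵀ *ᵥ fun j => (s j)⁻¹ * (v α (S.e.symm j)).re)
        (fun l => (s (S.inact l))⁻¹ * (v α (Sum.inr l)).re) := by
    intro α
    have h1 := S.completion_mulVec Q.Aᵀ (Q.dist p) (fun j => (v α (S.e.symm j)).re)
    simpa [inact] using h1
  have him : ∀ α, (S.completion Q.realΛ (Q.dist p) *ᵥ fun i => (v α i).im) =
      Sum.elim (Q.realΛ *ᵥ fun j => (s j)⁻¹ * (v α (S.e.symm j)).im)
        (fun l => (s (S.inact l))⁻¹ * (v α (Sum.inr l)).im) := by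
    intro α
    have h1 := S.completion_mulVec Q.realΛ (Q.dist p) (fun j => (v α (S.e.symm j)).im)
    simpa [inact] using h1
  simp only [hre, him] at hdet
  rw [det_realMatrix_sum] at hdet
  · have hY : (fun α : Fin 2 × Fin (m - n) => fun i =>
        (⟨(s (S.inact i))⁻¹ * (v (α.1, Sum.inr α.2) (Sum.inr i)).re,
          (s (S.inact i))⁻¹ * (v (α.1, Sum.inr α.2) (Sum.inr i)).im⟩ : ℂ)) =
        fun α => S.trivialEquiv (w α) := by
      funext α i
      rw [(hinr α.1 α.2).1, (hinr α.1 α.2).2]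
      exact Complex.ext (congrFun (hcancel (w α).2.1) (S.inact i))
        (congrFun (hcancel (w α).1.1) (S.inact i))
    have hX : (fun α : Fin 2 × Fin n => fun i =>
        (⟨(Q.Aᵀ *ᵥ fun j => (s j)⁻¹ * (v (α.1, Sum.inl α.2) (S.e.symm j)).re) i,
          (Q.realΛ *ᵥ fun j => (s j)⁻¹ * (v (α.1, Sum.inl α.2) (S.e.symm j)).im) i⟩ : ℂ)) =
        fun α i => ⟨(G *ᵥ fun k => (stdFrame α k).re) i,
          ((1 : Matrix (Fin n) (Fin n) ℝ) *ᵥ fun k => (stdFrame α k).im) i⟩ := by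
      funext ⟨a, k⟩
      obtain ⟨κ, hκ1, hκ2⟩ := hinl a k
      have hκ : Q.realΛ *ᵥ κ.1 = 0 := κ.2
      have hk := hcancel κ.1
      simp only [hκ1, hκ2, S.e.apply_symm_apply, mul_sub]
      have hsub : (Q.realΛ *ᵥ fun j => (s j)⁻¹ * (Q.interiorFrame p (a, k) j).im -
          (s j)⁻¹ * (κ.1 j * s j)) =
          Q.realΛ *ᵥ fun j => (s j)⁻¹ * (Q.interiorFrame p (a, k) j).im := by
        have h1 := Matrix.mulVec_sub Q.realΛ
          (fun j => (s j)⁻¹ * (Q.interiorFrame p (a, k) j).im) (fun j => (s j)⁻¹ * (κ.1 j * s j))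
        rw [hk, hκ, sub_zero] at h1
        rw [← h1]
        congr 1
        funext j
        exact congrArg ((s j)⁻¹ * (Q.interiorFrame p (a, k) j).im - ·) (congrFun hk j)
      rw [hsub]
      funext i
      fin_cases a
      · have h1 : (fun j => (s j)⁻¹ * (Q.interiorFrame p (0, k) j).re) =
            (diagonal (fun j => (2 * Q.dist p j)⁻¹) * Q.A) *ᵥ Pi.single k 1 := by
          funext j
          rw [Q.interiorFrame_point hd, Matrix.mulVec_single_one, Matrix.col_apply,
            Matrix.diagonal_mul, Complex.ofReal_re]
          have h2 : s j * s j = Q.dist p j := Real.mul_self_sqrt (hd j).le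
          have h3 := (hs j).ne'
          show (s j)⁻¹ * (Q.A j k / (2 * s j)) = _
          rw [← h2]
          field_simp
        have h4 : (fun j => (s j)⁻¹ * (Q.interiorFrame p (0, k) j).im) = 0 := by
          funext j
          rw [Q.interiorFrame_point hd, Complex.ofReal_im, mul_zero, Pi.zero_apply]
        show (⟨_, _⟩ : ℂ) = ⟨_, _⟩
        simp only [Fin.zero_eta]
        rw [h1, re_stdFrame_zero, im_stdFrame_zero, h4, Matrix.mulVec_mulVec,
          Matrix.mulVec_zero, Matrix.mulVec_zero,
          ← Matrix.mul_assoc]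
      · have h1 : (fun j => (s j)⁻¹ * (Q.interiorFrame p (1, k) j).im) =
            Pi.single (Fin.castLE Q.le k) 1 := by
          funext j
          rw [Q.interiorFrame_angle]
          by_cases hj : j = Fin.castLE Q.le k
          · subst hj
            simpa using inv_mul_cancel₀ (hs _).ne'
          · simp [hj]
        have h4 : (fun j => (s j)⁻¹ * (Q.interiorFrame p (1, k) j).re) = 0 := by
          funext j
          rw [Q.interiorFrame_angle]
          by_cases hj : j = Fin.castLE Q.le k <;> simp [hj]
        have h5 : Q.realΛ *ᵥ Pi.single (Fin.castLE Q.le k) 1 = Pi.single k 1 := by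
          funext i
          simp [realΛ_castLE, Pi.single_apply]
        show (⟨_, _⟩ : ℂ) = ⟨_, _⟩
        simp only [Fin.mk_one]
        rw [h1, re_stdFrame_one, im_stdFrame_one, h4, h5, Matrix.one_mulVec,
          Matrix.mulVec_zero, Matrix.mulVec_zero]
    simp only [Sum.elim_inl, Sum.elim_inr] at hdet
    rw [hX, hY, det_realMatrix_map, realMatrix_stdFrame, Matrix.det_one, Matrix.det_one, mul_one,
      mul_one, det_completion, det_completion] at hdet
    have hprod : 0 < ∏ i, (Real.sqrt (Q.dist p (S.e i)))⁻¹ :=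
      Finset.prod_pos fun i _ => inv_pos.2 (hs _)
    have hT : (Q.Aᵀ.submatrix id S.act).det = (Q.A.submatrix S.act id).det := by
      rw [← Matrix.det_transpose]; rfl
    rw [h0]
    rw [hT] at hdet
    set a := (Q.A.submatrix S.act id).det
    set b := (Q.realΛ.submatrix id S.act).det
    have hab : a * b ≠ 0 := mul_ne_zero S.det_normals S.det_realMinor_ne_zero
    set c := ∏ i, (Real.sqrt (Q.dist p (S.e i)))⁻¹
    set D := (realMatrix v).det
    set Y := (realMatrix fun α => S.trivialEquiv (w α)).det
    have hsq : 0 < (a * b) ^ 2 := by positivity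
    have key : G.det * (a * b * Y) = (a * b) ^ 2 * c ^ 2 * D := by
      linear_combination (a * b) * hdet
    constructor
    · intro hD
      exact pos_of_mul_pos_right (key ▸ by positivity) hG.le
    · intro hY
      exact pos_of_mul_pos_right (key ▸ mul_pos hG hY : 0 < (a * b) ^ 2 * c ^ 2 * D)
        (by positivity)
  · intro a l i
    have h1 : (fun j => (s j)⁻¹ * (v (a, Sum.inr l) (S.e.symm j)).re) = (w (a, l)).2.1 := by
      simp only [(hinr a l).1, S.e.apply_symm_apply]
      exact hcancel _
    have h2 : (fun j => (s j)⁻¹ * (v (a, Sum.inr l) (S.e.symm j)).im) = (w (a, l)).1.1 := by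
      simp only [(hinr a l).2, S.e.apply_symm_apply]
      exact hcancel _
    have h3 : Q.Aᵀ *ᵥ (w (a, l)).2.1 = 0 := (w (a, l)).2.2
    have h4 : Q.realΛ *ᵥ (w (a, l)).1.1 = 0 := (w (a, l)).1.2
    simp only [Sum.elim_inl]
    rw [h1, h2, h3, h4]
    rfl

end VertexSplitting
end QuasitoricPair

/-! ### Orientations and the representation over a vertex -/

namespace QuasitoricPair

variable {n m : ℕ} (Q : QuasitoricPair n m)

namespace VertexSplitting

variable {Q} (S : Q.VertexSplitting)

/-- The orientation of the trivial summand, read off at the vertex. The right-hand side does not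
depend on a point of the interior of `P`. -/
theorem isPositiveTrivialBasis_iff (w : Module.Basis (Fin 2 × Fin (m - n)) ℝ Q.W) :
    Q.IsPositiveTrivialBasis w ↔
      0 < (Q.A.submatrix S.act id).det * (Q.realΛ.submatrix id S.act).det *
        (realMatrix fun α => S.trivialEquiv (w α)).det := by
  constructor
  · intro h
    obtain ⟨p, hp⟩ := Q.full_dimensional
    obtain ⟨h, hh, hpos⟩ := h p hp
    exact (S.isPositiveFrame_interior_iff (Q.dist_pos_of_mem_interior hp) h hh w).1 hpos
  · intro hpos p hp
    obtain ⟨h, hh⟩ := Q.exists_horizontal_frame hp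
    exact ⟨h, hh,
      (S.isPositiveFrame_interior_iff (Q.dist_pos_of_mem_interior hp) h hh w).2 hpos⟩

variable {S}

/-- Over the vertex, the tangent space and the trivial summand map to complementary coordinate
subspaces. -/
theorem Over.isPositiveFrame_stableFrame_iff {z : Fin m → ℂ} (hz : S.Over z)
    (h : Fin 2 × Fin n → Q.horizontal z) (w : Fin 2 × Fin (m - n) → Q.W) :
    IsPositiveFrame (Q.stableFrame z h w) ↔
      0 < (realMatrix fun α => hz.horizontalEquiv (h α)).det *
        (realMatrix fun α => S.trivialEquiv (w α)).det := by
  let u : Fin n ⊕ Fin (m - n) → ℂ := Sum.elim 1 fun l => (z (S.inact l))⁻¹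
  have hu : ∀ i, u i ≠ 0 := by
    rintro (k | l)
    · exact one_ne_zero
    · exact inv_ne_zero (hz.2.2 l)
  let f : (Fin m → ℂ) ≃ₗ[ℂ] (Fin n ⊕ Fin (m - n) → ℂ) :=
    (LinearEquiv.funCongrLeft ℂ ℂ S.e).trans
      (LinearEquiv.piCongrRight fun i => LinearEquiv.smulOfNeZero ℂ ℂ (u i) (hu i))
  have hf : ∀ v i, f v i = u i * v (S.e i) := fun v i => rfl
  have hl : ∀ v k, f v (Sum.inl k) = v (S.act k) := fun v k => (hf v _).trans (one_mul _)
  have hr : ∀ v l, f v (Sum.inr l) = (z (S.inact l))⁻¹ * v (S.inact l) := fun v l => hf v _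
  rw [← isPositiveFrame_comp_equiv f, isPositiveFrame_iff_realMatrix, det_realMatrix_sum]
  · have h1 : (fun α : Fin 2 × Fin n => fun i =>
        f (Q.stableFrame z h w (α.1, Sum.inl α.2)) (Sum.inl i)) =
        fun α => hz.horizontalEquiv (h α) := by
      funext α i
      rw [hl]
      exact hz.cTauAt_act _ _ _
    have h2 : (fun α : Fin 2 × Fin (m - n) => fun i =>
        f (Q.stableFrame z h w (α.1, Sum.inr α.2)) (Sum.inr i)) =
        fun α => S.trivialEquiv (w α) := by
      funext α i
      rw [hr]
      refine (congrArg _ (hz.cTauAt_inact _ _ _)).trans ?_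
      rw [mul_comm, mul_assoc, mul_inv_cancel₀ (hz.2.2 i), mul_one]
    rw [h1, h2]
  · intro a l i
    rw [hl]
    exact hz.cTauAt_act _ _ _

variable (S)

/-- The representation of `Tⁿ` on `ℂᵐ` with the columns of the weight matrix as the weights on the
coordinate lines of the facets through the vertex, and trivial on the other coordinate lines. -/
def rep (t : Fin n → Circle) (v : Fin m → ℂ) : Fin m → ℂ := fun i =>
  Sum.elim (fun k => (torusChar (S.weights.col k) t : ℂ)) (fun _ => 1) (S.e.symm i) * v i

theorem rep_act (t : Fin n → Circle) (v : Fin m → ℂ) (k : Fin n) :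
    S.rep t v (S.act k) = torusChar (S.weights.col k) t * v (S.act k) := by
  simp [rep, act]

theorem rep_inact (t : Fin n → Circle) (v : Fin m → ℂ) (l : Fin (m - n)) :
    S.rep t v (S.inact l) = v (S.inact l) := by
  simp [rep, inact]

variable {S}

/-- Elements of `K` that fix a point over the vertex are trivial. -/
theorem Over.eq_one {z : Fin m → ℂ} (hz : S.Over z) {k : Fin m → Circle} (hk : k ∈ Q.K)
    (hkz : k • z = z) : k = 1 := by
  have h1 : ∀ l, k (S.inact l) = 1 := fun l => eq_one_of_smul_eq hkz (hz.2.2 l)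
  refine funext (S.forall_index.2 ⟨fun i => ?_, h1⟩)
  have hk' : Q.torusHom k = 1 := hk
  rw [← S.torusChar_weights h1, hk']
  simp [torusChar]

theorem Over.fibre_injective {z : Q.Z} (hz : S.Over z) : Function.Injective (Q.fibre z) := by
  intro v v' h
  obtain ⟨k, hk, h⟩ := Q.cls_eq_iff.1 h
  have h1 : k • z = z := congrArg Prod.fst h
  have h2 : k • v' = v := congrArg Prod.snd h
  rw [hz.eq_one hk (congrArg Subtype.val h1), one_smul] at h2
  exact h2.symm

theorem cTau_cls (y : Q.HorizontalBundle) (w : Q.W) :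
    Q.cTau (Q.cls y, w) = Q.fibre y.1.1 (Q.cTauAt y.1.1 (⟨y.1.2, y.2⟩, w)) := rfl

/-- Over a fixed point, `c_τ` is injective, so that the transformations `r` are given there by
their defining formula. -/
theorem Over.cTau_eq {z : Q.Z} (hz : S.Over z) {h : Q.horizontal z} {w : Q.W} {u : Q.TM × Q.W}
    (hu : Q.cTau u = Q.fibre z (Q.cTauAt z (h, w))) : u = (Q.cls ⟨(z, h.1), h.2⟩, w) := by
  obtain ⟨u1, w'⟩ := u
  obtain ⟨y, rfl⟩ : ∃ y : Q.HorizontalBundle, Q.cls y = u1 := Quotient.exists_rep u1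
  obtain ⟨k, hk, hkz⟩ := Q.cls_eq_iff.1 ((cTau_cls y w').symm.trans hu)
  have h1 : k • z = y.1.1 := congrArg Prod.fst hkz
  obtain ⟨⟨⟨z', h'⟩, hy⟩, hy'⟩ : ∃ y' : Q.HorizontalBundle, y' = k⁻¹ • y := ⟨_, rfl⟩
  have hcls : Q.cls y = Q.cls (⟨(z', h'), hy⟩ : Q.HorizontalBundle) := by
    rw [hy', Q.cls_smul _ (inv_mem hk)]
  have hz' : z' = z := by
    have h2 : z' = k⁻¹ • y.1.1 := congrArg (fun y : Q.HorizontalBundle => y.1.1) hy'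
    rw [h2, ← h1, inv_smul_smul]
  subst hz'
  rw [hcls, cTau_cls] at hu
  have h2 := hz.cTauAt_bijective.1 (hz.fibre_injective hu)
  obtain ⟨h3, rfl⟩ := Prod.ext_iff.1 h2
  have h4 : h' = h.1 := congrArg Subtype.val h3
  subst h4
  rw [hcls]

/-- An element `t` of `Tⁿ` acts through an element of `Tᵐ` that lifts it and fixes `z`. -/
theorem Over.r_fibre {z : Q.Z} (hz : S.Over z)
    (hfix : ∀ t : Fin n → Circle, t • Q.cls z = Q.cls z) (t : Fin n → Circle) (v : Fin m → ℂ) :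
    Q.r t (Q.fibre z v) = Q.fibre z (S.rep t v) := by
  obtain ⟨⟨h, w⟩, rfl⟩ := hz.cTauAt_bijective.2 v
  have hex : ∃ u, Q.cTau u = Q.fibre z (Q.cTauAt z (h, w)) := ⟨(Q.cls ⟨(z, h.1), h.2⟩, w), rfl⟩
  have hu : Classical.choose hex = _ := hz.cTau_eq (Classical.choose_spec hex)
  classical
  rw [r, Function.extend_def, dif_pos hex, hu]
  obtain ⟨s, rfl, hs⟩ := Q.exists_stabilizer hfix t
  have hs' : s • (z : Fin m → ℂ) = z := congrArg Subtype.val hs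
  have h1 : ∀ l, s (S.inact l) = 1 := fun l => eq_one_of_smul_eq hs' (hz.2.2 l)
  rw [Q.smul_cls_eq, cTau_cls]
  refine congrArg (Q.cls (X := Q.Z × (Fin m → ℂ))) (Prod.ext hs (funext ?_))
  rw [S.forall_index]
  refine ⟨fun k => ?_, fun l => ?_⟩
  · refine Eq.trans ?_ (S.rep_act _ _ _).symm
    rw [S.torusChar_weights h1, hz.cTauAt_act]
    refine (cTauAt_apply _ _ _ _).trans ?_
    show s (S.act k) • h.1 (S.act k) + _ * (s • (z : Fin m → ℂ)) (S.act k) = _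
    rw [hs', hz.2.1, mul_zero, add_zero, Circle.smul_def, smul_eq_mul]
  · refine Eq.trans ?_ (S.rep_inact _ _ _).symm
    rw [cTauAt_apply]
    refine (cTauAt_apply _ _ _ _).trans ?_
    show s (S.inact l) • h.1 (S.inact l) + _ * (s • (z : Fin m → ℂ)) (S.inact l) = _
    rw [hs', h1, one_smul]

/-- The trivial summand is the span of the coordinate lines of the facets that miss the vertex. -/
theorem Over.mem_trivialPart_iff {z : Q.Z} (hz : S.Over z)
    (hfix : ∀ t : Fin n → Circle, t • Q.cls z = Q.cls z) (v : Fin m → ℂ) :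
    v ∈ Q.trivialPart z ↔ ∀ k, v (S.act k) = 0 := by
  constructor
  · intro hv k
    refine Submodule.span_induction (p := fun v _ => v (S.act k) = 0) ?_ rfl ?_ ?_ hv
    · intro v hv
      by_contra hk
      refine S.weights_col_ne_zero k (torusChar_injective (funext fun t => ?_))
      have h1 := hv t
      rw [hz.r_fibre hfix] at h1
      have h2 := congrFun (hz.fibre_injective h1) (S.act k)
      rw [rep_act] at h2
      have h3 : torusChar (S.weights.col k) t = 1 :=
        Circle.ext (mul_right_cancel₀ hk (h2.trans (one_mul _).symm))
      rw [h3]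
      simp [torusChar]
    · intro a b _ _ ha hb
      rw [Pi.add_apply, ha, hb, add_zero]
    · intro c a _ ha
      rw [Pi.smul_apply, ha, smul_zero]
  · intro hv
    refine Submodule.subset_span fun t => ?_
    rw [hz.r_fibre hfix]
    congr 1
    refine funext (S.forall_index.2 ⟨fun k => ?_, fun l => S.rep_inact t v l⟩)
    rw [rep_act, hv, mul_zero]

/-- Modulo the trivial summand, the fibre becomes `ℂⁿ`, the tangent space of `M`. -/
theorem Over.isPositiveFrame_mkQ_iff {z : Q.Z} (hz : S.Over z)
    (hfix : ∀ t : Fin n → Circle, t • Q.cls z = Q.cls z) (h : Fin 2 × Fin n → Q.horizontal z) :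
    IsPositiveFrame (fun α => (Q.trivialPart z).mkQ (Q.cTauAt z (h α, 0))) ↔
      0 < (realMatrix fun α => hz.horizontalEquiv (h α)).det := by
  let L : (Fin m → ℂ) →ₗ[ℂ] (Fin n → ℂ) := LinearMap.funLeft ℂ ℂ S.act
  have hL : Function.Surjective L := LinearMap.funLeft_surjective_of_injective _ _ _ S.act_injective
  have hker : Q.trivialPart z = LinearMap.ker L := by
    ext v
    rw [hz.mem_trivialPart_iff hfix, LinearMap.mem_ker, funext_iff]
    rfl
  let f := (Submodule.quotEquivOfEq _ _ hker).trans (L.quotKerEquivOfSurjective hL)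
  rw [← isPositiveFrame_comp_equiv f, ← isPositiveFrame_iff_realMatrix]
  have : (fun α => f ((Q.trivialPart z).mkQ (Q.cTauAt z (h α, 0)))) =
      fun α => hz.horizontalEquiv (h α) := by
    funext α k
    exact hz.cTauAt_act _ _ _
  rw [this]

end VertexSplitting
end QuasitoricPair

/-! ### The sign and the weights of a fixed point -/

namespace QuasitoricPair

variable {n m : ℕ} {Q : QuasitoricPair n m}

namespace VertexSplitting

variable (S : Q.VertexSplitting)

/-- A polytope of positive dimension has a facet that misses the vertex: the cone over the vertex is
unbounded. -/
theorem nonempty_inact {Q : QuasitoricPair n m} (S : Q.VertexSplitting) [Nonempty (Fin n)] :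
    Nonempty (Fin (m - n)) := by
  by_contra hempty
  rw [not_nonempty_iff] at hempty
  obtain ⟨k⟩ := ‹Nonempty (Fin n)›
  obtain ⟨p, hp⟩ := Q.full_dimensional
  have hp : p ∈ Q.body := interior_subset hp
  obtain ⟨d, hd⟩ : ∃ d : Fin n → ℝ, ∀ k, (Q.A *ᵥ d) (S.act k) = 1 := by
    have hu : IsUnit (Q.A.submatrix S.act id).det := S.det_normals.isUnit
    refine ⟨(Q.A.submatrix S.act id)⁻¹ *ᵥ 1, fun k => ?_⟩
    have h := Matrix.mulVec_mulVec 1 (Q.A.submatrix S.act id) (Q.A.submatrix S.act id)⁻¹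
    rw [Matrix.mul_nonsing_inv _ hu, Matrix.one_mulVec] at h
    exact congrFun h k
  have hray : ∀ t : ℝ, 0 ≤ t → p + t • d ∈ Q.body := by
    intro t ht
    show ∀ i, 0 ≤ Q.dist (p + t • d) i
    refine S.forall_index.2 ⟨fun k => ?_, fun l => hempty.elim l⟩
    rw [Q.dist_add_smul, hd, mul_one]
    exact add_nonneg (hp _) ht
  obtain ⟨B, hB⟩ := Q.isCompact_body.bddAbove_image
    ((continuous_apply (S.act k)).comp Q.continuous_dist).continuousOn
  have hpk : 0 ≤ Q.dist p (S.act k) := hp _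
  have h1 := hB (Set.mem_image_of_mem _ (hray (|B| + 1) (by positivity)))
  simp only [Function.comp_apply, Q.dist_add_smul, hd, mul_one] at h1
  linarith [le_abs_self B]

theorem isPositiveTangentBasis_iff {z : Fin m → ℂ} (hz : S.Over z)
    (h : Module.Basis (Fin 2 × Fin n) ℝ (Q.horizontal z)) :
    Q.IsPositiveTangentBasis z h ↔ ∃ w : Module.Basis (Fin 2 × Fin (m - n)) ℝ Q.W,
      0 < (Q.A.submatrix S.act id).det * (Q.realΛ.submatrix id S.act).det *
        (realMatrix fun α => S.trivialEquiv (w α)).det ∧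
      0 < (realMatrix fun α => hz.horizontalEquiv (h α)).det *
        (realMatrix fun α => S.trivialEquiv (w α)).det := by
  simp only [IsPositiveTangentBasis, S.isPositiveTrivialBasis_iff,
    hz.isPositiveFrame_stableFrame_iff]

variable {S}

/-- The sign of a fixed point compares the orientation given by the normals of the facets with the
one given by the columns of `Λ`. -/
theorem sign_eq {x : Q.M} (hx : ∀ t : Fin n → Circle, t • x = x) (hex : ∃ z : Q.Z, Q.cls z = x)
    (hS : ∀ z : Q.Z, Q.cls z = x → S.Over z) :
    Q.sign x = (SignType.sign
      ((Q.A.submatrix S.act id).det * (Q.realΛ.submatrix id S.act).det) : ℤ) := by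
  have hab := mul_ne_zero S.det_normals S.det_realMinor_ne_zero
  change (Q.A.submatrix S.act id).det * (Q.realΛ.submatrix id S.act).det ≠ 0 at hab
  set ab := (Q.A.submatrix S.act id).det * (Q.realΛ.submatrix id S.act).det with hab_def
  rcases lt_or_gt_of_ne hab with hneg | hpos
  · rw [sign_neg hneg, QuasitoricPair.sign, if_neg]
    · rfl
    intro hall
    have hn : Nonempty (Fin n) := by
      by_contra hempty
      rw [not_nonempty_iff] at hempty
      rw [hab_def, Matrix.det_isEmpty, Matrix.det_isEmpty] at hneg
      norm_num at hneg
    have := S.nonempty_inact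
    obtain ⟨z, hzx⟩ := hex
    have hz := hS z hzx
    -- A positive tangent basis that becomes negative in `ℂⁿ`: the trivial summand has to be given
    -- the orientation opposite to the complex one, which is possible as it is nonzero.
    obtain ⟨h, hh⟩ := exists_basis_det_eq_one hz.horizontalEquiv
    obtain ⟨h', hh'⟩ := exists_swap_basis h
    obtain ⟨w, hw⟩ := exists_basis_det_eq_one S.trivialEquiv
    obtain ⟨w', hw'⟩ := exists_swap_basis w
    have h1 := hw' S.trivialEquiv
    have h2 := hh' hz.horizontalEquiv
    rw [hw] at h1
    rw [hh] at h2
    have h3 := hall z hzx h' ((S.isPositiveTangentBasis_iff hz h').2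
      ⟨w', by rw [h1]; linarith, by rw [h1, h2]; norm_num⟩)
    rw [hz.isPositiveFrame_mkQ_iff (by rw [hzx]; exact hx), h2] at h3
    norm_num at h3
  · rw [sign_pos hpos, QuasitoricPair.sign, if_pos]
    · rfl
    intro z hzx h hh
    have hz := hS z hzx
    obtain ⟨w, h1, h2⟩ := (S.isPositiveTangentBasis_iff hz h).1 hh
    rw [hz.isPositiveFrame_mkQ_iff (by rw [hzx]; exact hx)]
    exact pos_of_mul_pos_left h2 (pos_of_mul_pos_right h1 hpos.le).le

/-- Normals of any positive lengths define the same orientation as the rows of `A_P`. -/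
theorem sign_det_mul_normals (N : Matrix (Fin n) (Fin n) ℝ)
    (hN : ∀ k, Q.IsInwardNormal (S.act k) (N.col k)) :
    SignType.sign (((Q.minor S.act).map (fun a : ℤ => (a : ℝ))) * N).det =
      SignType.sign ((Q.A.submatrix S.act id).det * (Q.realΛ.submatrix id S.act).det) := by
  choose c hc hN using hN
  have h1 : N = (Q.A.submatrix S.act id)ᵀ * diagonal c := by
    ext i k
    rw [Matrix.mul_diagonal, mul_comm]
    exact congrFun (hN k) i
  have h2 : (Q.minor S.act).map (fun a : ℤ => (a : ℝ)) = Q.realΛ.submatrix id S.act := rfl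
  rw [h1, h2, Matrix.det_mul, Matrix.det_mul, Matrix.det_transpose, Matrix.det_diagonal,
    ← mul_assoc, sign_mul, sign_pos (Finset.prod_pos fun k _ => hc k), mul_one, mul_comm]

theorem rep_single (t : Fin n → Circle) (k : Fin n) (c : ℂ) :
    S.rep t (Pi.single (S.act k) c) =
      Pi.single (S.act k) ((torusChar (S.weights.col k) t : ℂ) * c) := by
  refine funext (S.forall_index.2 ⟨fun k' => ?_, fun l => ?_⟩)
  · rw [rep_act]
    by_cases h : k' = k
    · subst h; simp
    · simp [S.act_injective.ne h]
  · rw [rep_inact]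
    simp [(S.act_ne_inact k l).symm]

theorem isWeightOfLine_iff {x : Q.M} (hx : ∀ t : Fin n → Circle, t • x = x)
    (hex : ∃ z : Q.Z, Q.cls z = x) (hS : ∀ z : Q.Z, Q.cls z = x → S.Over z) (k : Fin n)
    (w : Fin n → ℤ) : Q.IsWeightOfLine x (S.act k) w ↔ w = S.weights.col k := by
  constructor
  · intro h
    obtain ⟨z, hzx⟩ := hex
    have hz := hS z hzx
    refine torusChar_injective (funext fun t => ?_)
    have h1 := h z hzx t 1
    rw [hz.r_fibre (by rw [hzx]; exact hx), rep_single] at h1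
    have h2 := congrFun (hz.fibre_injective h1) (S.act k)
    simp only [Pi.single_eq_same, mul_one] at h2
    exact (Circle.ext h2).symm
  · rintro rfl z hzx t c
    rw [(hS z hzx).r_fibre (by rw [hzx]; exact hx), rep_single]

/-- An eigenvector for a nontrivial character lies on a coordinate line, because the characters on
the coordinate lines are distinct. -/
theorem exists_eq_weight {v : Fin m → ℂ} (hv : v ≠ 0) {w : Fin n → ℤ} (hw : w ≠ 0)
    (h : ∀ t, S.rep t v = (torusChar w t : ℂ) • v) :
    ∃ k, w = S.weights.col k ∧ v = Pi.single (S.act k) (v (S.act k)) := by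
  have hact : ∀ k, v (S.act k) ≠ 0 → w = S.weights.col k := by
    intro k hk
    refine torusChar_injective (funext fun t => Circle.ext ?_)
    have h1 := congrFun (h t) (S.act k)
    rw [rep_act, Pi.smul_apply, smul_eq_mul] at h1
    exact (mul_right_cancel₀ hk h1).symm
  have hinact : ∀ l, v (S.inact l) = 0 := by
    intro l
    by_contra hl
    refine hw (torusChar_injective (funext fun t => Circle.ext ?_))
    have h1 := congrFun (h t) (S.inact l)
    rw [rep_inact, Pi.smul_apply, smul_eq_mul] at h1
    have h2 := mul_right_cancel₀ hl ((one_mul _).trans h1)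
    rw [← h2]
    simp [torusChar]
  obtain ⟨k, hk⟩ : ∃ k, v (S.act k) ≠ 0 := by
    by_contra! hall
    exact hv (funext (S.forall_index.2 ⟨hall, hinact⟩))
  refine ⟨k, hact k hk, funext (S.forall_index.2 ⟨fun k' => ?_, fun l => ?_⟩)⟩
  · by_cases hkk : k' = k
    · subst hkk; simp
    · rw [Pi.single_eq_of_ne (S.act_injective.ne hkk)]
      by_contra h'
      exact hkk (S.weights_col_injective ((hact k' h').symm.trans (hact k hk)))
  · rw [hinact, Pi.single_eq_of_ne (S.act_ne_inact k l).symm]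

/-- Any diagonalization of `r_x` has the columns of the weight matrix as its nontrivial weights. -/
theorem isWeightFamily_iff {x : Q.M} (hx : ∀ t : Fin n → Circle, t • x = x)
    (hex : ∃ z : Q.Z, Q.cls z = x) (hS : ∀ z : Q.Z, Q.cls z = x → S.Over z)
    (w : Fin n → Fin n → ℤ) :
    Q.IsWeightFamily x w ↔ ∃ σ : Equiv.Perm (Fin n), ∀ k, w k = S.weights.col (σ k) := by
  constructor
  · rintro ⟨hw, hb⟩
    obtain ⟨z, hzx⟩ := hex
    have hz := hS z hzx
    obtain ⟨b, hb⟩ := hb z hzx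
    have heig : ∀ k t, S.rep t (b (Sum.inl k)) = (torusChar (w k) t : ℂ) • b (Sum.inl k) := by
      intro k t
      have h1 := hb t (Pi.single k 1) 0
      rw [hz.r_fibre (by rw [hzx]; exact hx)] at h1
      simpa [Pi.single_apply] using hz.fibre_injective h1
    choose σ hσ hbσ using fun k => exists_eq_weight (b.ne_zero (Sum.inl k)) (hw k) (heig k)
    have hinj : Function.Injective σ := by
      intro k k' hkk
      by_contra hne
      have hb0 : ∀ k, b (Sum.inl k) (S.act (σ k)) ≠ 0 := fun k h0 =>
        b.ne_zero (Sum.inl k) (by rw [hbσ k, h0, Pi.single_zero])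
      -- Two basis vectors on the same coordinate line would be linearly dependent.
      have h1 : b (Sum.inl k') (S.act (σ k')) • b (Sum.inl k) =
          b (Sum.inl k) (S.act (σ k)) • b (Sum.inl k') := by
        conv_lhs => rw [hbσ k]
        conv_rhs => rw [hbσ k']
        rw [hkk, ← Pi.single_smul, ← Pi.single_smul, smul_eq_mul, smul_eq_mul, mul_comm]
      have h2 := congrArg (fun v => b.repr v (Sum.inl k)) h1
      simp [Ne.symm hne] at h2
      exact hb0 k' h2
    exact ⟨Equiv.ofBijective σ (Finite.injective_iff_bijective.1 hinj), hσ⟩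
  · rintro ⟨σ, hσ⟩
    refine ⟨fun k => hσ k ▸ S.weights_col_ne_zero (σ k), fun z hzx => ?_⟩
    have hz := hS z hzx
    let b : Module.Basis (Fin n ⊕ Fin (m - n)) ℂ (Fin m → ℂ) :=
      (Pi.basisFun ℂ (Fin m)).reindex
        (S.e.symm.trans (Equiv.sumCongr σ.symm (Equiv.refl _)))
    have hb1 : ∀ k, b (Sum.inl k) = Pi.single (S.act (σ k)) 1 := fun k => by simp [b, act]
    have hb2 : ∀ l, b (Sum.inr l) = Pi.single (S.inact l) 1 := fun l => by simp [b, inact]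
    have hc : ∀ (c : Fin n → ℂ) (d : Fin (m - n) → ℂ),
        (∀ k, (∑ k, c k • b (Sum.inl k) + ∑ l, d l • b (Sum.inr l)) (S.act (σ k)) = c k) ∧
        ∀ l, (∑ k, c k • b (Sum.inl k) + ∑ l, d l • b (Sum.inr l)) (S.inact l) = d l := by
      intro c d
      constructor
      · intro k
        simp [hb1, hb2, Pi.single_apply, S.act_ne_inact, S.act_injective.eq_iff]
      · intro l
        simp [hb1, hb2, Pi.single_apply, fun k l => (S.act_ne_inact k l).symm,
          S.inact_injective.eq_iff]
    refine ⟨b, fun t c d => ?_⟩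
    rw [hz.r_fibre (by rw [hzx]; exact hx)]
    congr 1
    refine funext (S.forall_index.2 ⟨fun k => ?_, fun l => ?_⟩)
    · obtain ⟨k, rfl⟩ := σ.surjective k
      rw [rep_act, (hc _ _).1, (hc _ _).1, hσ]
    · rw [rep_inact, (hc _ _).2, (hc _ _).2]

end VertexSplitting
end QuasitoricPair

end

theorem mainTheorem3 {n m : ℕ} (Q : QuasitoricPair n m) (x : Q.M)
    (hx : ∀ t : Fin n → Circle, t • x = x) :
    ∃ j : Fin n ↪o Fin m,
      (∀ i, x ∈ Q.facial i ↔ i ∈ Set.range j) ∧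
      (∀ N : Matrix (Fin n) (Fin n) ℝ, (∀ k, Q.IsInwardNormal (j k) (N.col k)) →
        Q.sign x =
          (SignType.sign ((Q.minor j).map (fun a : ℤ => (a : ℝ)) * N).det : ℤ)) ∧
      ∃ W : Matrix (Fin n) (Fin n) ℤ, Wᵀ * Q.minor j = 1 ∧
        (∀ (k : Fin n) (w : Fin n → ℤ), Q.IsWeightOfLine x (j k) w ↔ w = W.col k) ∧
        (∀ w : Fin n → Fin n → ℤ, Q.IsWeightFamily x w ↔
          ∃ σ : Equiv.Perm (Fin n), ∀ k, w k = W.col (σ k)) := by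
  obtain ⟨j, S, hSj, hex, hS⟩ := Q.exists_splitting_of_fixed hx
  have hj : S.act = j := funext hSj
  refine ⟨j, fun i => ?_, fun N hN => ?_, S.weights, ?_, fun k w => ?_, fun w => ?_⟩
  · obtain ⟨z, hzx⟩ := hex
    rw [← hj, ← (hS z hzx).cls_mem_facial_iff, hzx]
  · rw [← hj, QuasitoricPair.VertexSplitting.sign_det_mul_normals N (by simpa only [hSj] using hN)]
    exact QuasitoricPair.VertexSplitting.sign_eq hx hex hS
  · rw [← hj]
    exact S.weights_transpose_mul
  · rw [← hSj]
    exact QuasitoricPair.VertexSplitting.isWeightOfLine_iff hx hex hS k w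
  · exact QuasitoricPair.VertexSplitting.isWeightFamily_iff hx hex hS w
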